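/- \textbf{Setting.} Let $1\le k<d$, let $\xi:\mathbb{R}^d\to\mathbb{R}^k$ be smooth, let $\overline V:\mathbb{R}^d\to\mathbb{R}$ be $C^2$, let $M\in\mathbb{R}^{d\times d}$ be symmetric positive definite, and let $\tau>0$. Write $\nabla\xi(x)\in\mathbb{R}^{d\times k}$ for the matrix with entries $\partial\xi_j/\partial x_i(x)$. Assume that $\Sigma=\{x\in\mathbb{R}^d: \xi(x)=0\}$ is compact and that $\nabla\xi(x)^T\nabla\xi(x)$ is positive definite for all $x\in\Sigma$. Let $$T^*\Sigma=\{(x,p)\in\mathbb{R}^d\times\mathbb{R}^d:\ \xi(x)=0,\ \nabla\xi(x)^TM^{-1}p=0\},$$ a submanifold of $\mathbb{R}^d\times\mathbb{R}^d$. "Neighborhood" means a relatively open subset of $T^*\Sigma$ containing the point. For $x\in\Sigma$ put $$P_M(x)=I_d-\nabla\xi(x)\big(\nabla\xi(x)^TM^{-1}\nabla\xi(x)\big)^{-1}\nabla\xi(x)^TM^{-1},$$ $$G_{M,x}(y)=\tfrac1\tau P_M(x)M\Big(y-x+\tfrac{\tau^2}{2}M^{-1}\nabla\overline V(x)\Big)\quad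 (y\in\Sigma),$$ $$C_{M,x}=\{y\in\Sigma:\ \det(\nabla\xi(y)^TM^{-1}\nabla\xi(x))=0\}.$$ For $(x,p)\in T^*\Sigma$ and $c_x,c_p\in\mathbb{R}^k$ let $F(x,p,c_x,c_p)=(\hat x,-\hat p)$ with $$\hat x=x+\tau M^{-1}p-\tfrac{\tau^2}{2}M^{-1}\nabla\overline V(x)+\tau M^{-1}\nabla\xi(x)c_x,$$ $$\hat p=p-\tfrac\tau2\big(\nabla\overline V(x)+\nabla\overline V(\hat x)\big)+\nabla\xi(x)c_x+\nabla\xi(\hat x)c_p,$$ and let $\mathcal F(z)=\{z'\in T^*\Sigma:\ z'=F(z,c_x,c_p)\text{ for some }c_x,c_p\in\mathbb{R}^k\}$ be the set of all outcomes of one step of the RATTLE scheme with momentum reversal started at $z\in T^*\Sigma$. \textbf{Proposition.} Let $z=(x,p)\in T^*\Sigma$ and $z'=(x^1,p^{1,-})\in\mathcal F(z)$ with $x^1\in\Sigma\setminus C_{M,x}$. Then there are a neighborhood $\mathcal O\subset T^*\Sigma$ of $z$ and a $C^1$ map $\Upsilon_1:\mathcal O\to\Sigma$ with the following properties. 1.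 $\Upsilon_1(z)=x^1$ and $G_{M,\bar x}(\Upsilon_1(\bar z))=\bar p$ for all $\bar z=(\bar x,\bar p)\in\mathcal O$. Moreover, if $\mathcal O'\subset T^*\Sigma$ is a neighborhood of $z$ and $\widetilde\Upsilon_1:\mathcal O'\to\Sigma$ is a $C^1$ map with $\widetilde\Upsilon_1(z)=x^1$ and $G_{M,\bar x}(\widetilde\Upsilon_1(\bar z))=\bar p$ for all $\bar z=(\bar x,\bar p)\in\mathcal O'$, then $\widetilde\Upsilon_1=\Upsilon_1$ on the connected component of $\mathcal O\cap\mathcal O'$ that contains $z$. 2. The functions on $\mathcal O$ given, for $\bar z=(\bar x,\bar p)$ and $y=\Upsilon_1(\bar z)$, by $$\lambda_x(\bar z)=\tfrac1\tau\big[\nabla\xi(\bar x)^TM^{-1}\nabla\xi(\bar x)\big]^{-1}\nabla\xi(\bar x)^T\Big[y-\bar x-\tau M^{-1}\bar p+\tfrac{\tau^2}2M^{-1}\nabla\overline V(\bar x)\Big],$$ $$\lambda_p(\bar z)=-\big[\nabla\xi(y)^TM^{-1}\nabla\xi(y)\big]^{-1}\nabla\xi(y)^TM^{-1}\Big(\bar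 p-\tfrac\tau2\big(\nabla\overline V(\bar x)+\nabla\overline V(y)\big)+\nabla\xi(\bar x)\lambda_x(\bar z)\Big)$$ are $C^1$, $z'=F(z,\lambda_x(z),\lambda_p(z))$, and $F(\bar z,\lambda_x(\bar z),\lambda_p(\bar z))\in\mathcal F(\bar z)$ for all $\bar z\in\mathcal O$. Moreover, if $\mathcal O'\subset T^*\Sigma$ is a neighborhood of $z$ and $\widetilde\lambda_x,\widetilde\lambda_p:\mathcal O'\to\mathbb{R}^k$ are $C^1$ functions with $z'=F(z,\widetilde\lambda_x(z),\widetilde\lambda_p(z))$ and $F(\bar z,\widetilde\lambda_x(\bar z),\widetilde\lambda_p(\bar z))\in\mathcal F(\bar z)$ for all $\bar z\in\mathcal O'$, then $\widetilde\lambda_x=\lambda_x$ and $\widetilde\lambda_p=\lambda_p$ on the connected component of $\mathcal O\cap\mathcal O'$ that contains $z$. 3. Let $\Upsilon(\bar z)=F(\bar z,\lambda_x(\bar z),\lambda_p(\bar z))$ for $\bar z\in\mathcal O$. There is a neighborhood $\mathcal Q\subset\mathcal O$ of $z$ such that $\Upsilon$ is a $C^1$-diffeomorphism from $\mathcal Q$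 onto $\Upsilon(\mathcal Q)$, which is a neighborhood of $z'$ in $T^*\Sigma$; $\Upsilon(z)=z'$; $|\det D\Upsilon|\equiv1$ on $\mathcal Q$; and $\mathcal F(\bar z)\cap\Upsilon(\mathcal Q)=\{\Upsilon(\bar z)\}$ for all $\bar z\in\mathcal Q$. Here $|\det D\Upsilon(\bar z)|$ is the factor by which $D\Upsilon(\bar z)$ multiplies the Liouville (symplectic) volume $|\det(\omega(w_i,w_j))_{i,j}|^{1/2}$ of $2(d-k)$ vectors $w_i\in T_{\bar z}(T^*\Sigma)$, where $\omega((u,a),(v,b))=u^Tb-a^Tv$. -/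

import Mathlib

open scoped Matrix ContDiff

noncomputable section

namespace RattleScheme

variable {d k : ℕ}

/-- The phase space `ℝ^d × ℝ^d` of positions and momenta.  Only the topology and the smooth structure
of `ℝ^d` are used, never its norm, and the Euclidean scalar product is written as `⬝ᵥ`. -/
abbrev Phase (d : ℕ) : Type := (Fin d → ℝ) × (Fin d → ℝ)

/-- The `d × k` matrix `∇ξ(x)` with entries `∂ξ_j/∂x_i (x)`. -/
def gradXi (ξ : (Fin d → ℝ) → (Fin k → ℝ)) (x : Fin d → ℝ) : Matrix (Fin d) (Fin k) ℝ :=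
  Matrix.of fun i j => fderiv ℝ ξ x (Pi.single i 1) j

/-- The gradient `∇V(x)`. -/
def gradV (V : (Fin d → ℝ) → ℝ) (x : Fin d → ℝ) : Fin d → ℝ :=
  fun i => fderiv ℝ V x (Pi.single i 1)

/-- The level set `Σ = {x | ξ(x) = 0}`. -/
def levelSet (ξ : (Fin d → ℝ) → (Fin k → ℝ)) : Set (Fin d → ℝ) := {x | ξ x = 0}

/-- The map `(x, p) ↦ (ξ(x), ∇ξ(x)ᵀ M⁻¹ p)` whose zero set is the cotangent bundle. -/
def phaseConstraint (ξ : (Fin d → ℝ) → (Fin k → ℝ)) (M : Matrix (Fin d) (Fin d) ℝ)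
    (z : Phase d) : (Fin k → ℝ) × (Fin k → ℝ) :=
  (ξ z.1, (gradXi ξ z.1)ᵀ *ᵥ (M⁻¹ *ᵥ z.2))

/-- The cotangent bundle `T^*Σ = {(x, p) | ξ(x) = 0, ∇ξ(x)ᵀ M⁻¹ p = 0}`. -/
def cotangentBundle (ξ : (Fin d → ℝ) → (Fin k → ℝ)) (M : Matrix (Fin d) (Fin d) ℝ) :
    Set (Phase d) :=
  {z | phaseConstraint ξ M z = 0}

/-- The matrix `∇ξ(y)ᵀ M⁻¹ ∇ξ(x)`. -/
def crossGram (ξ : (Fin d → ℝ) → (Fin k → ℝ)) (M : Matrix (Fin d) (Fin d) ℝ)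
    (y x : Fin d → ℝ) : Matrix (Fin k) (Fin k) ℝ :=
  (gradXi ξ y)ᵀ * M⁻¹ * gradXi ξ x

/-- The set `C_{M,x} = {y ∈ Σ | det(∇ξ(y)ᵀ M⁻¹ ∇ξ(x)) = 0}`. -/
def criticalSet (ξ : (Fin d → ℝ) → (Fin k → ℝ)) (M : Matrix (Fin d) (Fin d) ℝ)
    (x : Fin d → ℝ) : Set (Fin d → ℝ) :=
  {y | y ∈ levelSet ξ ∧ (crossGram ξ M y x).det = 0}

/-- The projection `P_M(x) = I - ∇ξ(x) (∇ξ(x)ᵀ M⁻¹ ∇ξ(x))⁻¹ ∇ξ(x)ᵀ M⁻¹` onto `T_x^*Σ`. -/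
def projM (ξ : (Fin d → ℝ) → (Fin k → ℝ)) (M : Matrix (Fin d) (Fin d) ℝ)
    (x : Fin d → ℝ) : Matrix (Fin d) (Fin d) ℝ :=
  1 - gradXi ξ x * (crossGram ξ M x x)⁻¹ * (gradXi ξ x)ᵀ * M⁻¹

/-- The map `G_{M,x}(y) = τ⁻¹ P_M(x) M (y - x + (τ²/2) M⁻¹ ∇V(x))`. -/
def mapG (ξ : (Fin d → ℝ) → (Fin k → ℝ)) (V : (Fin d → ℝ) → ℝ) (M : Matrix (Fin d) (Fin d) ℝ)
    (τ : ℝ) (x y : Fin d → ℝ) : Fin d → ℝ :=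
  (1 / τ) • (projM ξ M x *ᵥ (M *ᵥ (y - x + (τ ^ 2 / 2) • (M⁻¹ *ᵥ gradV V x))))

/-- The new position `x + τ M⁻¹ p - (τ²/2) M⁻¹ ∇V(x) + τ M⁻¹ ∇ξ(x) c_x`. -/
def stepPos (ξ : (Fin d → ℝ) → (Fin k → ℝ)) (V : (Fin d → ℝ) → ℝ) (M : Matrix (Fin d) (Fin d) ℝ)
    (τ : ℝ) (z : Phase d) (cx : Fin k → ℝ) : Fin d → ℝ :=
  z.1 + τ • (M⁻¹ *ᵥ z.2) - (τ ^ 2 / 2) • (M⁻¹ *ᵥ gradV V z.1)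
    + τ • (M⁻¹ *ᵥ (gradXi ξ z.1 *ᵥ cx))

/-- The unconstrained map `F(x, p, c_x, c_p) = (x̄, -p̄)`, where `x̄` is the new position and
`p̄ = p - (τ/2)(∇V(x) + ∇V(x̄)) + ∇ξ(x) c_x + ∇ξ(x̄) c_p`. -/
def mapF (ξ : (Fin d → ℝ) → (Fin k → ℝ)) (V : (Fin d → ℝ) → ℝ) (M : Matrix (Fin d) (Fin d) ℝ)
    (τ : ℝ) (z : Phase d) (cx cp : Fin k → ℝ) : Phase d :=
  (stepPos ξ V M τ z cx,
    -(z.2 - (τ / 2) • (gradV V z.1 + gradV V (stepPos ξ V M τ z cx))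
      + gradXi ξ z.1 *ᵥ cx + gradXi ξ (stepPos ξ V M τ z cx) *ᵥ cp))

/-- The set `𝓕(z)` of all outcomes of one-step RATTLE with momentum reversal started at `z`. -/
def outcomes (ξ : (Fin d → ℝ) → (Fin k → ℝ)) (V : (Fin d → ℝ) → ℝ)
    (M : Matrix (Fin d) (Fin d) ℝ) (τ : ℝ) (z : Phase d) : Set (Phase d) :=
  {z' | z' ∈ cotangentBundle ξ M ∧ ∃ cx cp : Fin k → ℝ, z' = mapF ξ V M τ z cx cp}

/-- The position multiplier
`λ_x(z) = τ⁻¹ (∇ξ(x)ᵀ M⁻¹ ∇ξ(x))⁻¹ ∇ξ(x)ᵀ (Υ₁(z) - x - τ M⁻¹ p + (τ²/2) M⁻¹ ∇V(x))`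
attached to a position map `Υ₁`. -/
def lambdaX (ξ : (Fin d → ℝ) → (Fin k → ℝ)) (V : (Fin d → ℝ) → ℝ) (M : Matrix (Fin d) (Fin d) ℝ)
    (τ : ℝ) (Υ₁ : Phase d → (Fin d → ℝ)) (z : Phase d) : Fin k → ℝ :=
  (1 / τ) • ((crossGram ξ M z.1 z.1)⁻¹ *ᵥ ((gradXi ξ z.1)ᵀ *ᵥ
    (Υ₁ z - z.1 - τ • (M⁻¹ *ᵥ z.2) + (τ ^ 2 / 2) • (M⁻¹ *ᵥ gradV V z.1))))

/-- The momentum multiplier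
`λ_p(z) = -(∇ξ(y)ᵀ M⁻¹ ∇ξ(y))⁻¹ ∇ξ(y)ᵀ M⁻¹ (p - (τ/2)(∇V(x) + ∇V(y)) + ∇ξ(x) λ_x(z))`, `y = Υ₁(z)`,
attached to a position map `Υ₁`. -/
def lambdaP (ξ : (Fin d → ℝ) → (Fin k → ℝ)) (V : (Fin d → ℝ) → ℝ) (M : Matrix (Fin d) (Fin d) ℝ)
    (τ : ℝ) (Υ₁ : Phase d → (Fin d → ℝ)) (z : Phase d) : Fin k → ℝ :=
  -((crossGram ξ M (Υ₁ z) (Υ₁ z))⁻¹ *ᵥ ((gradXi ξ (Υ₁ z))ᵀ *ᵥ (M⁻¹ *ᵥ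
    (z.2 - (τ / 2) • (gradV V z.1 + gradV V (Υ₁ z))
      + gradXi ξ z.1 *ᵥ lambdaX ξ V M τ Υ₁ z))))

/-- The map `Υ = F(·, λ_x(·), λ_p(·))` attached to a position map `Υ₁`. -/
def rattleMap (ξ : (Fin d → ℝ) → (Fin k → ℝ)) (V : (Fin d → ℝ) → ℝ)
    (M : Matrix (Fin d) (Fin d) ℝ) (τ : ℝ) (Υ₁ : Phase d → (Fin d → ℝ)) (z : Phase d) : Phase d :=
  mapF ξ V M τ z (lambdaX ξ V M τ Υ₁ z) (lambdaP ξ V M τ Υ₁ z)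

/-- `O` is a (relatively open) neighborhood of `z` in the subspace `S`. -/
def IsNeighborhoodIn {Z : Type*} [TopologicalSpace Z] (S O : Set Z) (z : Z) : Prop :=
  z ∈ O ∧ ∃ U : Set Z, IsOpen U ∧ O = S ∩ U

/-- `f` is `C¹` on the subset `O` (a relatively open subset of an embedded submanifold): near every
point of `O`, it agrees on `O` with a `C¹` map defined on an open subset of the ambient space. -/
def IsC1On {Z W : Type*} [NormedAddCommGroup Z] [NormedSpace ℝ Z] [NormedAddCommGroup W]
    [NormedSpace ℝ W] (f : Z → W) (O : Set Z) : Prop :=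
  ∀ z ∈ O, ∃ U : Set Z, IsOpen U ∧ z ∈ U ∧
    ∃ g : Z → W, ContDiffOn ℝ 1 g U ∧ Set.EqOn f g (O ∩ U)

/-- `f` is a `C¹`-diffeomorphism from `O` onto its image. -/
def IsC1DiffeoOnto {Z W : Type*} [NormedAddCommGroup Z] [NormedSpace ℝ Z] [NormedAddCommGroup W]
    [NormedSpace ℝ W] (f : Z → W) (O : Set Z) : Prop :=
  IsC1On f O ∧ ∃ g : W → Z, IsC1On g (f '' O) ∧ Set.LeftInvOn g f O

/-- The tangent space of `T^*Σ` at `z`, i.e. the kernel of the differential of the constraints. -/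
def tangentSpaceAt (ξ : (Fin d → ℝ) → (Fin k → ℝ)) (M : Matrix (Fin d) (Fin d) ℝ)
    (z : Phase d) : Submodule ℝ (Phase d) :=
  LinearMap.ker (fderiv ℝ (phaseConstraint ξ M) z : Phase d →ₗ[ℝ] (Fin k → ℝ) × (Fin k → ℝ))

/-- The canonical symplectic form `Σ_i dx_i ∧ dp_i` of `ℝ^d × ℝ^d`. -/
def symplecticForm (w w' : Phase d) : ℝ := w.1 ⬝ᵥ w'.2 - w.2 ⬝ᵥ w'.1

/-- The (unsigned) Liouville volume `|det (ω(w_i, w_j))|^{1/2}` of the parallelepiped spanned by the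
vectors `w_i`. -/
def liouvilleVolume {ι : Type*} [Fintype ι] [DecidableEq ι] (w : ι → Phase d) : ℝ :=
  √|(Matrix.of fun i j => symplecticForm (w i) (w j)).det|

/-- The factor `|det (D|_T)|` by which a linear map `D` multiplies Liouville volumes of
parallelepipeds in `T`; the choice of the basis is immaterial, see
`liouvilleVolume_map_eq`. -/
def liouvilleAbsDet (T : Submodule ℝ (Phase d)) (D : Phase d →L[ℝ] Phase d) : ℝ :=
  liouvilleVolume (fun i => D (Module.finBasis ℝ T i : Phase d)) /
    liouvilleVolume (fun i => (Module.finBasis ℝ T i : Phase d))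

/-- `|det Df(z)| = c` for a map `f` on the relatively open subset `O` of `T^*Σ`: `f` is
differentiable at `z` along `O`, and its differential multiplies Liouville volumes in the tangent
space `T_z(T^*Σ)` by `c`.  Two derivatives of `f` along `O` differ only off the tangent space. -/
def HasAbsDetOn (ξ : (Fin d → ℝ) → (Fin k → ℝ)) (M : Matrix (Fin d) (Fin d) ℝ)
    (f : Phase d → Phase d) (O : Set (Phase d)) (z : Phase d) (c : ℝ) : Prop :=
  DifferentiableWithinAt ℝ f O z ∧
    ∀ D : Phase d →L[ℝ] Phase d, HasFDerivWithinAt f D O z →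
      liouvilleAbsDet (tangentSpaceAt ξ M z) D = c

lemma symplecticForm_sum {ι : Type*} [Fintype ι] (a a' : ι → ℝ) (b : ι → Phase d) :
    symplecticForm (∑ i, a i • b i) (∑ j, a' j • b j)
      = ∑ j, (∑ i, a i * symplecticForm (b i) (b j)) * a' j := by
  simp only [symplecticForm, Prod.fst_sum, Prod.snd_sum, Prod.smul_fst, Prod.smul_snd,
    sum_dotProduct, dotProduct_sum, smul_dotProduct, dotProduct_smul, smul_eq_mul]
  rw [← Finset.sum_sub_distrib]
  refine Finset.sum_congr rfl fun j _ => ?_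
  rw [← mul_sub, ← Finset.sum_sub_distrib, mul_comm]
  simp only [mul_sub]

lemma liouvilleVolume_sum {ι : Type*} [Fintype ι] [DecidableEq ι] (A : Matrix ι ι ℝ)
    (b : ι → Phase d) :
    liouvilleVolume (fun i => ∑ j, A i j • b j) = |A.det| * liouvilleVolume b := by
  have h : (Matrix.of fun i j => symplecticForm (∑ l, A i l • b l) (∑ l, A j l • b l))
      = A * (Matrix.of fun i j => symplecticForm (b i) (b j)) * Aᵀ := by
    ext i j
    simp [symplecticForm_sum, Matrix.mul_apply]
  rw [liouvilleVolume, h, Matrix.det_mul, Matrix.det_mul, Matrix.det_transpose, liouvilleVolume,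
    ← Real.sqrt_sq (abs_nonneg A.det), ← Real.sqrt_mul (sq_nonneg _)]
  congr 1
  rw [abs_mul, abs_mul]
  ring

theorem liouvilleVolume_map_eq (T : Submodule ℝ (Phase d)) (D : Phase d →L[ℝ] Phase d)
    (hT : liouvilleVolume (fun i => (Module.finBasis ℝ T i : Phase d)) ≠ 0)
    (w : Fin (Module.finrank ℝ T) → T) :
    liouvilleVolume (fun i => D (w i : Phase d))
      = liouvilleAbsDet T D * liouvilleVolume (fun i => (w i : Phase d)) := by
  obtain ⟨A, hA⟩ : ∃ A : Matrix (Fin (Module.finrank ℝ T)) (Fin (Module.finrank ℝ T)) ℝ,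
      ∀ i, (w i : Phase d) = ∑ j, A i j • (Module.finBasis ℝ T j : Phase d) := by
    refine ⟨Matrix.of fun i j => (Module.finBasis ℝ T).repr (w i) j, fun i => ?_⟩
    have h := congrArg T.subtype ((Module.finBasis ℝ T).sum_repr (w i))
    rw [map_sum] at h
    simpa only [map_smul, Submodule.subtype_apply, Matrix.of_apply] using h.symm
  have h2 : (fun i => D (w i : Phase d))
      = fun i => ∑ j, A i j • D (Module.finBasis ℝ T j : Phase d) := by
    funext i
    rw [hA i, map_sum]
    simp only [map_smul]
  rw [h2, funext hA, liouvilleVolume_sum A (fun j => D (Module.finBasis ℝ T j : Phase d)),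
    liouvilleVolume_sum A (fun j => (Module.finBasis ℝ T j : Phase d)), liouvilleAbsDet]
  field_simp

end RattleScheme

end

open RattleScheme

/-! A step from `w` is fixed by its position multiplier: once the new position lies in Σ, tangency
of the new momentum is a linear system for the other multiplier with an invertible Gram matrix,
solved by `momMult`. By `mapG_eq_iff`, solving `G_{M,x}(y) = p` means that `y` is a new position for
some multiplier, so parts 1 and 2 both concern the equation `ξ (stepPos w c) = 0`. Its derivative in
`c` is `τ ∇ξ(x¹)ᵀ M⁻¹ ∇ξ(x)`, invertible exactly off the critical set, and the implicit function
theorem yields a `C¹` solution `c` on an open subset of the ambient phase space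
(`exists_isLocalMultiplier`). Its local uniqueness spreads over connected components by a clopen
argument (`eqOn_of_isPreconnected`).

Part 3 rests on reversibility: exchanging the multipliers undoes a step (`mapF_mapF`), and
noncriticality is symmetric in the two positions. The same construction at `z'` therefore gives a
second branch, and the two branches are mutually inverse between relatively open sets
(`branch_image`).

For the volume, the step is a kick, a drift, a kick and a momentum flip. Kicks and drift preserve
the symplectic form on directions tangent to Σ, and the flip changes its sign
(`exists_hasFDerivAt_mapF`). The form is nondegenerate on the tangent spaces, so the Liouville
factor is 1. -/

namespace RattleScheme

variable {d k : ℕ} {ξ : (Fin d → ℝ) → (Fin k → ℝ)} {V : (Fin d → ℝ) → ℝ}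
  {M : Matrix (Fin d) (Fin d) ℝ} {τ : ℝ}

/-! ### Algebra of one step -/

/-- The momentum multiplier as a function of the initial state and the position multiplier. -/
noncomputable def momMult (ξ : (Fin d → ℝ) → (Fin k → ℝ)) (V : (Fin d → ℝ) → ℝ)
    (M : Matrix (Fin d) (Fin d) ℝ) (τ : ℝ) (w : Phase d) (c : Fin k → ℝ) : Fin k → ℝ :=
  -((crossGram ξ M (stepPos ξ V M τ w c) (stepPos ξ V M τ w c))⁻¹ *ᵥ
    ((gradXi ξ (stepPos ξ V M τ w c))ᵀ *ᵥ (M⁻¹ *ᵥ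
      (w.2 - (τ / 2) • (gradV V w.1 + gradV V (stepPos ξ V M τ w c)) + gradXi ξ w.1 *ᵥ c))))

lemma crossGram_mulVec (x y : Fin d → ℝ) (c : Fin k → ℝ) :
    crossGram ξ M y x *ᵥ c = (gradXi ξ y)ᵀ *ᵥ (M⁻¹ *ᵥ (gradXi ξ x *ᵥ c)) := by
  simp [crossGram, Matrix.mul_assoc]

/-- Full rank makes `∇ξ(x)` injective, so compressing the positive definite `M⁻¹` by it stays
positive definite. -/
lemma isUnit_det_crossGram_self (hM : M.PosDef) {x : Fin d → ℝ}
    (hx : ((gradXi ξ x)ᵀ * gradXi ξ x).PosDef) : IsUnit (crossGram ξ M x x).det := by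
  have hinj : Function.Injective (gradXi ξ x).mulVec := by
    intro a b hab
    refine Matrix.mulVec_injective_of_isUnit hx.isUnit ?_
    simp only [← Matrix.mulVec_mulVec]
    exact congrArg _ hab
  have h := hM.inv.conjTranspose_mul_mul_same hinj
  rw [Matrix.conjTranspose_eq_transpose_of_trivial] at h
  exact (Matrix.isUnit_iff_isUnit_det _).1 h.isUnit

/-- This makes noncriticality symmetric in the old and new positions, as the reversed step requires.
-/
lemma crossGram_transpose (hM : M.PosDef) (x y : Fin d → ℝ) :
    (crossGram ξ M y x)ᵀ = crossGram ξ M x y := by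
  have h : Mᵀ = M := by
    rw [← Matrix.conjTranspose_eq_transpose_of_trivial]; exact hM.1
  simp [crossGram, Matrix.transpose_nonsing_inv, h, Matrix.mul_assoc]

lemma inv_mulVec_mulVec {A : Matrix (Fin k) (Fin k) ℝ} (hA : IsUnit A.det) (c : Fin k → ℝ) :
    A⁻¹ *ᵥ (A *ᵥ c) = c := by
  rw [Matrix.mulVec_mulVec, Matrix.nonsing_inv_mul _ hA, Matrix.one_mulVec]

lemma mulVec_inv_mulVec {A : Matrix (Fin k) (Fin k) ℝ} (hA : IsUnit A.det) (c : Fin k → ℝ) :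
    A *ᵥ (A⁻¹ *ᵥ c) = c := by
  rw [Matrix.mulVec_mulVec, Matrix.mul_nonsing_inv _ hA, Matrix.one_mulVec]

lemma mem_cotangentBundle {w : Phase d} : w ∈ cotangentBundle ξ M ↔
    ξ w.1 = 0 ∧ (gradXi ξ w.1)ᵀ *ᵥ (M⁻¹ *ᵥ w.2) = 0 := by
  simp [cotangentBundle, phaseConstraint]

lemma lambdaX_of_eq_stepPos (hτ : τ ≠ 0) {Υ₁ : Phase d → (Fin d → ℝ)} {w : Phase d}
    (hx : IsUnit (crossGram ξ M w.1 w.1).det) {c : Fin k → ℝ}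
    (h : Υ₁ w = stepPos ξ V M τ w c) : lambdaX ξ V M τ Υ₁ w = c := by
  have e : Υ₁ w - w.1 - τ • (M⁻¹ *ᵥ w.2) + (τ ^ 2 / 2) • (M⁻¹ *ᵥ gradV V w.1)
      = τ • (M⁻¹ *ᵥ (gradXi ξ w.1 *ᵥ c)) := by
    rw [h, stepPos]; abel
  rw [lambdaX, e, Matrix.mulVec_smul, Matrix.mulVec_smul, ← crossGram_mulVec,
    inv_mulVec_mulVec hx, smul_smul, one_div_mul_cancel hτ, one_smul]

lemma lambdaP_of_eq_stepPos {Υ₁ : Phase d → (Fin d → ℝ)} {w : Phase d} {c : Fin k → ℝ}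
    (hX : lambdaX ξ V M τ Υ₁ w = c) (h : Υ₁ w = stepPos ξ V M τ w c) :
    lambdaP ξ V M τ Υ₁ w = momMult ξ V M τ w c := by
  rw [lambdaP, momMult, hX, h]

/-- The projection `P_M` kills the range of `∇ξ(x)` and fixes cotangent vectors. Conversely, what it
removes from a vector lies in that range, and its coefficient, divided by `τ`, is the multiplier. -/
lemma mapG_eq_iff (hM : IsUnit M.det) (hτ : τ ≠ 0) {w : Phase d}
    (hx : IsUnit (crossGram ξ M w.1 w.1).det) (hw : w ∈ cotangentBundle ξ M) (y : Fin d → ℝ) :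
    mapG ξ V M τ w.1 y = w.2 ↔ ∃ c, y = stepPos ξ V M τ w c := by
  have hP : ∀ q, projM ξ M w.1 *ᵥ q = q - gradXi ξ w.1 *ᵥ ((crossGram ξ M w.1 w.1)⁻¹ *ᵥ
      ((gradXi ξ w.1)ᵀ *ᵥ (M⁻¹ *ᵥ q))) := by
    intro q
    simp [projM, Matrix.sub_mulVec, Matrix.mul_assoc]
  have hp := (mem_cotangentBundle.1 hw).2
  constructor
  · intro h
    rw [mapG, hP, inv_mulVec_mulVec hM] at h
    set r := y - w.1 + (τ ^ 2 / 2) • (M⁻¹ *ᵥ gradV V w.1) with hr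
    set e := (crossGram ξ M w.1 w.1)⁻¹ *ᵥ ((gradXi ξ w.1)ᵀ *ᵥ r)
    refine ⟨(1 / τ) • e, ?_⟩
    have h2 : M⁻¹ *ᵥ w.2 = (1 / τ) • (r - M⁻¹ *ᵥ (gradXi ξ w.1 *ᵥ e)) := by
      rw [← h, Matrix.mulVec_smul, Matrix.mulVec_sub, inv_mulVec_mulVec hM]
    rw [stepPos, h2, Matrix.mulVec_smul, Matrix.mulVec_smul, smul_smul, smul_smul,
      mul_one_div_cancel hτ, one_smul, one_smul, hr]
    abel
  · rintro ⟨c, rfl⟩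
    have e : stepPos ξ V M τ w c - w.1 + (τ ^ 2 / 2) • (M⁻¹ *ᵥ gradV V w.1)
        = M⁻¹ *ᵥ (τ • (w.2 + gradXi ξ w.1 *ᵥ c)) := by
      rw [stepPos, Matrix.mulVec_smul, Matrix.mulVec_add, smul_add]; abel
    rw [mapG, e, mulVec_inv_mulVec hM, Matrix.mulVec_smul, smul_smul, one_div_mul_cancel hτ,
      one_smul, hP, Matrix.mulVec_add, Matrix.mulVec_add, hp, zero_add, ← crossGram_mulVec,
      inv_mulVec_mulVec hx, add_sub_cancel_right]

/-- Tangency of the new momentum is affine in `e`, with linear part the Gram matrix at the new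
position. -/
lemma mapF_mem_cotangentBundle_iff {w : Phase d} {c e : Fin k → ℝ}
    (hy : ξ (stepPos ξ V M τ w c) = 0 →
      IsUnit (crossGram ξ M (stepPos ξ V M τ w c) (stepPos ξ V M τ w c)).det) :
    mapF ξ V M τ w c e ∈ cotangentBundle ξ M ↔
      ξ (stepPos ξ V M τ w c) = 0 ∧ e = momMult ξ V M τ w c := by
  rw [mem_cotangentBundle]
  refine and_congr_right fun h => ?_
  have hu := hy h
  simp only [mapF]
  rw [Matrix.mulVec_neg, Matrix.mulVec_neg, neg_eq_zero, Matrix.mulVec_add, Matrix.mulVec_add,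
    ← crossGram_mulVec, momMult]
  constructor
  · intro h2
    rw [eq_neg_of_add_eq_zero_left h2, Matrix.mulVec_neg, neg_neg, inv_mulVec_mulVec hu]
  · rintro rfl
    rw [Matrix.mulVec_neg, mulVec_inv_mulVec hu, add_neg_cancel]

/-- With multiplier `e`, the terms in `∇V` and `∇ξ` at the new position cancel, and the drift by the
half-step momentum is retraced. -/
lemma stepPos_mapF (w : Phase d) (c e : Fin k → ℝ) :
    stepPos ξ V M τ (mapF ξ V M τ w c e) e = w.1 := by
  have h : stepPos ξ V M τ (mapF ξ V M τ w c e) e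
      = stepPos ξ V M τ w c + τ • (M⁻¹ *ᵥ (mapF ξ V M τ w c e).2)
        - (τ ^ 2 / 2) • (M⁻¹ *ᵥ gradV V (stepPos ξ V M τ w c))
        + τ • (M⁻¹ *ᵥ (gradXi ξ (stepPos ξ V M τ w c) *ᵥ e)) := rfl
  rw [h]
  simp only [mapF]
  generalize hg : gradV V (stepPos ξ V M τ w c) = g
  generalize gradXi ξ (stepPos ξ V M τ w c) = B
  rw [stepPos]
  simp only [Matrix.mulVec_neg, Matrix.mulVec_add, Matrix.mulVec_sub, Matrix.mulVec_smul]
  module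

/-- One step of the scheme with momentum reversal is undone by exchanging the multipliers. -/
lemma mapF_mapF (w : Phase d) (c e : Fin k → ℝ) :
    mapF ξ V M τ (mapF ξ V M τ w c e) e c = w := by
  have h := stepPos_mapF (ξ := ξ) (V := V) (M := M) (τ := τ) w c e
  refine Prod.ext h ?_
  have h2 : (mapF ξ V M τ (mapF ξ V M τ w c e) e c).2
      = -((mapF ξ V M τ w c e).2 - (τ / 2) • (gradV V (stepPos ξ V M τ w c) +
        gradV V (stepPos ξ V M τ (mapF ξ V M τ w c e) e))
      + gradXi ξ (stepPos ξ V M τ w c) *ᵥ e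
      + gradXi ξ (stepPos ξ V M τ (mapF ξ V M τ w c e) e) *ᵥ c) := rfl
  rw [h2, h]
  simp only [mapF]
  module


/-! ### Smoothness of the ingredients -/

lemma contDiffAt_matrix_mul {E : Type*} [NormedAddCommGroup E] [NormedSpace ℝ E]
    {m n l : Type*} [Fintype n] {s : E} {r : WithTop ℕ∞} {A : E → Matrix m n ℝ} {B : E → Matrix n l ℝ}
    (hA : ∀ i j, ContDiffAt ℝ r (fun w => A w i j) s)
    (hB : ∀ i j, ContDiffAt ℝ r (fun w => B w i j) s) (i : m) (j : l) :
    ContDiffAt ℝ r (fun w => (A w * B w) i j) s := by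
  simp only [Matrix.mul_apply]
  exact ContDiffAt.sum fun a _ => (hA i a).mul (hB a j)

section MatrixSmoothness

variable {E : Type*} [NormedAddCommGroup E] [NormedSpace ℝ E] {m n : Type*} [Fintype m] [Fintype n]
  {s : E} {r : WithTop ℕ∞}

lemma contDiffAt_mulVec {A : E → Matrix m n ℝ} {v : E → n → ℝ}
    (hA : ∀ i j, ContDiffAt ℝ r (fun w => A w i j) s) (hv : ContDiffAt ℝ r v s) :
    ContDiffAt ℝ r (fun w => A w *ᵥ v w) s := by
  refine contDiffAt_pi.2 fun i => ?_
  simp only [Matrix.mulVec, dotProduct]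
  exact ContDiffAt.sum fun j _ => (hA i j).mul (contDiffAt_pi.1 hv j)

lemma contDiffAt_const_mulVec (A : Matrix m n ℝ) {v : E → n → ℝ} (hv : ContDiffAt ℝ r v s) :
    ContDiffAt ℝ r (fun w => A *ᵥ v w) s :=
  contDiffAt_mulVec (fun _ _ => contDiffAt_const) hv

lemma contDiffAt_det [DecidableEq n] {A : E → Matrix n n ℝ}
    (hA : ∀ i j, ContDiffAt ℝ r (fun w => A w i j) s) :
    ContDiffAt ℝ r (fun w => (A w).det) s := by
  simp only [Matrix.det_apply]
  exact ContDiffAt.sum fun σ _ => (contDiffAt_prod fun i _ => hA _ _).const_smul _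

/-- Cramer's rule: the inverse is the adjugate over the determinant, both polynomial in the entries.
-/
lemma contDiffAt_matrix_inv [DecidableEq n] {A : E → Matrix n n ℝ}
    (hA : ∀ i j, ContDiffAt ℝ r (fun w => A w i j) s) (hs : IsUnit (A s).det) (i j : n) :
    ContDiffAt ℝ r (fun w => (A w)⁻¹ i j) s := by
  simp only [Matrix.inv_def, Matrix.smul_apply, Ring.inverse_eq_inv', Matrix.adjugate_apply,
    smul_eq_mul]
  refine ((contDiffAt_det hA).inv hs.ne_zero).mul (contDiffAt_det fun a b => ?_)
  simp only [Matrix.updateRow_apply]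
  split_ifs
  exacts [contDiffAt_const, hA _ _]

end MatrixSmoothness

section Smoothness

variable {E : Type*} [NormedAddCommGroup E] [NormedSpace ℝ E] {s : E}

lemma contDiff_gradV (hV : ContDiff ℝ 2 V) : ContDiff ℝ 1 (gradV V) := by
  refine contDiff_pi.2 fun i => ?_
  exact (hV.fderiv_right (m := 1) (by norm_num)).clm_apply contDiff_const

lemma contDiff_gradXi_apply (hξ : ContDiff ℝ ∞ ξ) (i : Fin d) (j : Fin k) :
    ContDiff ℝ 1 (fun x => gradXi ξ x i j) := by
  have h : ContDiff ℝ 1 (fderiv ℝ ξ) := hξ.fderiv_right (m := 1) (by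
    rw [one_add_one_eq_two]; exact WithTop.coe_le_coe.2 le_top)
  exact contDiff_pi.1 (h.clm_apply contDiff_const) j

lemma contDiffAt_crossGram (hξ : ContDiff ℝ ∞ ξ) {f g : E → Fin d → ℝ} (hf : ContDiffAt ℝ 1 f s)
    (hg : ContDiffAt ℝ 1 g s) (i j : Fin k) :
    ContDiffAt ℝ 1 (fun w => crossGram ξ M (f w) (g w) i j) s := by
  have h1 : ∀ a b, ContDiffAt ℝ 1 (fun w => gradXi ξ (f w) a b) s := fun a b =>
    (contDiff_gradXi_apply hξ a b).contDiffAt.comp s hf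
  have h2 : ∀ a b, ContDiffAt ℝ 1 (fun w => gradXi ξ (g w) a b) s := fun a b =>
    (contDiff_gradXi_apply hξ a b).contDiffAt.comp s hg
  refine contDiffAt_matrix_mul (A := fun w => (gradXi ξ (f w))ᵀ * M⁻¹)
    (B := fun w => gradXi ξ (g w)) (fun a b => ?_) h2 i j
  exact contDiffAt_matrix_mul (A := fun w => (gradXi ξ (f w))ᵀ) (B := fun _ => M⁻¹)
    (fun a b => h1 b a) (fun _ _ => contDiffAt_const) a b

lemma contDiffAt_gradXi_mulVec (hξ : ContDiff ℝ ∞ ξ) {f : E → Fin d → ℝ} {c : E → Fin k → ℝ}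
    (hf : ContDiffAt ℝ 1 f s) (hc : ContDiffAt ℝ 1 c s) :
    ContDiffAt ℝ 1 (fun w => gradXi ξ (f w) *ᵥ c w) s :=
  contDiffAt_mulVec (fun _ _ => (contDiff_gradXi_apply hξ _ _).contDiffAt.comp s hf) hc

lemma contDiffAt_gradXi_transpose_mulVec (hξ : ContDiff ℝ ∞ ξ) {f c : E → Fin d → ℝ}
    (hf : ContDiffAt ℝ 1 f s) (hc : ContDiffAt ℝ 1 c s) :
    ContDiffAt ℝ 1 (fun w => (gradXi ξ (f w))ᵀ *ᵥ c w) s :=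
  contDiffAt_mulVec (fun _ _ => (contDiff_gradXi_apply hξ _ _).contDiffAt.comp s hf) hc

lemma contDiffAt_stepPos (hξ : ContDiff ℝ ∞ ξ) (hV : ContDiff ℝ 2 V) {f : E → Phase d}
    {c : E → Fin k → ℝ} (hf : ContDiffAt ℝ 1 f s) (hc : ContDiffAt ℝ 1 c s) :
    ContDiffAt ℝ 1 (fun w => stepPos ξ V M τ (f w) (c w)) s := by
  have h1 := hf.fst
  have h2 := hf.snd
  exact ((h1.add ((contDiffAt_const_mulVec _ h2).const_smul τ)).sub
    ((contDiffAt_const_mulVec _ ((contDiff_gradV hV).contDiffAt.comp s h1)).const_smul _)).add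
    ((contDiffAt_const_mulVec _ (contDiffAt_gradXi_mulVec hξ h1 hc)).const_smul _)

lemma contDiffAt_momMult (hξ : ContDiff ℝ ∞ ξ) (hV : ContDiff ℝ 2 V) {f : E → Phase d}
    {c : E → Fin k → ℝ} (hf : ContDiffAt ℝ 1 f s) (hc : ContDiffAt ℝ 1 c s)
    (hs : IsUnit (crossGram ξ M (stepPos ξ V M τ (f s) (c s))
      (stepPos ξ V M τ (f s) (c s))).det) :
    ContDiffAt ℝ 1 (fun w => momMult ξ V M τ (f w) (c w)) s := by
  have hy := contDiffAt_stepPos (M := M) (τ := τ) hξ hV hf hc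
  have hg := contDiff_gradV hV
  refine (contDiffAt_mulVec (contDiffAt_matrix_inv (contDiffAt_crossGram hξ hy hy) hs)
    (contDiffAt_gradXi_transpose_mulVec hξ hy (contDiffAt_const_mulVec _ ?_))).neg
  exact (hf.snd.sub (((hg.contDiffAt.comp s hf.fst).add
    (hg.contDiffAt.comp s hy)).const_smul _)).add (contDiffAt_gradXi_mulVec hξ hf.fst hc)

lemma contDiffAt_mapF (hξ : ContDiff ℝ ∞ ξ) (hV : ContDiff ℝ 2 V) {f : E → Phase d}
    {c e : E → Fin k → ℝ} (hf : ContDiffAt ℝ 1 f s) (hc : ContDiffAt ℝ 1 c s)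
    (he : ContDiffAt ℝ 1 e s) :
    ContDiffAt ℝ 1 (fun w => mapF ξ V M τ (f w) (c w) (e w)) s := by
  have hy := contDiffAt_stepPos (M := M) (τ := τ) hξ hV hf hc
  have hg := contDiff_gradV hV
  exact hy.prodMk (((hf.snd.sub (((hg.contDiffAt.comp s hf.fst).add
    (hg.contDiffAt.comp s hy)).const_smul _)).add (contDiffAt_gradXi_mulVec hξ hf.fst hc)).add
    (contDiffAt_gradXi_mulVec hξ hy he)).neg

/-- `lambdaX` sees the position map only through its value, so a constant map turns the new position
into an independent variable. -/
lemma contDiffAt_lambdaX (hξ : ContDiff ℝ ∞ ξ) (hV : ContDiff ℝ 2 V) {f : E → Phase d}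
    {y : E → Fin d → ℝ} (hf : ContDiffAt ℝ 1 f s) (hy : ContDiffAt ℝ 1 y s)
    (hs : IsUnit (crossGram ξ M (f s).1 (f s).1).det) :
    ContDiffAt ℝ 1 (fun w => lambdaX ξ V M τ (fun _ => y w) (f w)) s := by
  have hg := contDiff_gradV hV
  refine (contDiffAt_mulVec (contDiffAt_matrix_inv (contDiffAt_crossGram hξ hf.fst hf.fst) hs)
    (contDiffAt_gradXi_transpose_mulVec hξ hf.fst ?_)).const_smul _
  exact ((hy.sub hf.fst).sub ((contDiffAt_const_mulVec _ hf.snd).const_smul _)).add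
    ((contDiffAt_const_mulVec _ (hg.contDiffAt.comp s hf.fst)).const_smul _)

end Smoothness

/-! ### Local solution of the position constraint -/

lemma fderiv_apply_eq_gradXi (x u : Fin d → ℝ) :
    fderiv ℝ ξ x u = (gradXi ξ x)ᵀ *ᵥ u := by
  ext j
  conv_lhs => rw [pi_eq_sum_univ' u]
  simp [map_sum, Matrix.mulVec, dotProduct, gradXi, mul_comm, Finset.sum_apply]

/-- The new position is affine in the multiplier, so differentiating along `c₀ + t e` in two ways
gives the partial derivative. This is where the critical set enters. -/
lemma fderiv_constraint_stepPos (hξ : ContDiff ℝ ∞ ξ) (z : Phase d) (c₀ e : Fin k → ℝ)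
    (cdf : DifferentiableAt ℝ (fun q : Phase d × (Fin k → ℝ) => ξ (stepPos ξ V M τ q.1 q.2))
      (z, c₀)) :
    fderiv ℝ (fun q : Phase d × (Fin k → ℝ) => ξ (stepPos ξ V M τ q.1 q.2)) (z, c₀) (0, e)
      = τ • (crossGram ξ M (stepPos ξ V M τ z c₀) z.1 *ᵥ e) := by
  have hξ1 : ContDiff ℝ 1 ξ := hξ.of_le (WithTop.coe_le_coe.2 le_top)
  set Φ : Phase d × (Fin k → ℝ) → (Fin k → ℝ) := fun q => ξ (stepPos ξ V M τ q.1 q.2) with hΦ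
  have hline : HasDerivAt (fun t : ℝ => stepPos ξ V M τ z (c₀ + t • e))
      (τ • (M⁻¹ *ᵥ (gradXi ξ z.1 *ᵥ e))) 0 := by
    have : (fun t : ℝ => stepPos ξ V M τ z (c₀ + t • e))
        = fun t => t • (τ • (M⁻¹ *ᵥ (gradXi ξ z.1 *ᵥ e))) + stepPos ξ V M τ z c₀ := by
      funext t
      simp only [stepPos, Matrix.mulVec_add, Matrix.mulVec_smul]
      module
    rw [this]
    simpa using ((hasDerivAt_id (0 : ℝ)).smul_const
      (τ • (M⁻¹ *ᵥ (gradXi ξ z.1 *ᵥ e)))).add_const (stepPos ξ V M τ z c₀)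
  have h1 : HasDerivAt (fun t : ℝ => Φ (z, c₀ + t • e))
      (fderiv ℝ ξ (stepPos ξ V M τ z c₀) (τ • (M⁻¹ *ᵥ (gradXi ξ z.1 *ᵥ e)))) 0 := by
    have hd := (hξ1.differentiable one_ne_zero (stepPos ξ V M τ z c₀)).hasFDerivAt
    refine HasFDerivAt.comp_hasDerivAt_of_eq (x := (0 : ℝ)) hd hline ?_
    simp
  have h2 : HasDerivAt (fun t : ℝ => Φ (z, c₀ + t • e)) (fderiv ℝ Φ (z, c₀) (0, e)) 0 := by
    have hd := cdf.hasFDerivAt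
    have hl : HasDerivAt (fun t : ℝ => ((z, c₀ + t • e) : Phase d × (Fin k → ℝ))) (0, e) 0 := by
      refine (hasDerivAt_const _ _).prodMk ?_
      simpa using ((hasDerivAt_id (0 : ℝ)).smul_const e).const_add c₀
    exact HasFDerivAt.comp_hasDerivAt_of_eq (x := (0 : ℝ)) hd hl (by simp)
  have h3 := h2.unique h1
  rw [fderiv_apply_eq_gradXi, Matrix.mulVec_smul, ← crossGram_mulVec] at h3
  exact h3

/-- Since `F` is finite-dimensional, injectivity of the partial derivative already makes it
invertible. -/
lemma exists_implicit_function {E F : Type*} [NormedAddCommGroup E] [NormedSpace ℝ E]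
    [CompleteSpace E] [NormedAddCommGroup F] [NormedSpace ℝ F] [FiniteDimensional ℝ F]
    {Φ : E × F → F} {z : E} {c₀ : F} (hΦ : ContDiffAt ℝ 1 Φ (z, c₀)) (h0 : Φ (z, c₀) = 0)
    (hinj : ∀ e, fderiv ℝ Φ (z, c₀) (0, e) = 0 → e = 0) :
    ∃ c : E → F, c z = c₀ ∧ ContDiffAt ℝ 1 c z ∧ (∀ᶠ w in nhds z, Φ (w, c w) = 0) ∧
      ∀ᶠ v in nhds (z, c₀), Φ v = 0 → v.2 = c v.1 := by
  have := FiniteDimensional.complete ℝ F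
  have if₂ : (fderiv ℝ Φ (z, c₀) ∘L .inr ℝ E F).IsInvertible := by
    have hinj' : Function.Injective (fderiv ℝ Φ (z, c₀) ∘L .inr ℝ E F) :=
      (injective_iff_map_eq_zero _).2 hinj
    exact ⟨(LinearEquiv.ofInjectiveEndo (fderiv ℝ Φ (z, c₀) ∘L
      .inr ℝ E F).toLinearMap hinj').toContinuousLinearEquiv, by ext; rfl⟩
  refine ⟨hΦ.implicitFunction one_ne_zero if₂, hΦ.implicitFunction_apply_self one_ne_zero if₂,
    hΦ.contDiffAt_implicitFunction one_ne_zero if₂, ?_, ?_⟩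
  · filter_upwards [hΦ.eventually_apply_implicitFunction one_ne_zero if₂] with w hw
    exact hw.trans h0
  · filter_upwards [hΦ.eventually_apply_eq_iff_implicitFunction one_ne_zero if₂] with v hv h
    exact (hv.1 (h.trans h0.symm)).symm

/-- On the open set `U`, `c` is a `C¹` position multiplier, and it is the only one whose new position
lies in the open set `Y`. -/
structure IsLocalMultiplier (ξ : (Fin d → ℝ) → (Fin k → ℝ)) (V : (Fin d → ℝ) → ℝ)
    (M : Matrix (Fin d) (Fin d) ℝ) (τ : ℝ) (U : Set (Phase d)) (Y : Set (Fin d → ℝ))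
    (c : Phase d → Fin k → ℝ) : Prop where
  isOpen_domain : IsOpen U
  isOpen_target : IsOpen Y
  contDiffAt : ∀ w ∈ U, ContDiffAt ℝ 1 c w
  constraint : ∀ w ∈ U, ξ (stepPos ξ V M τ w (c w)) = 0
  mem_target : ∀ w ∈ U, stepPos ξ V M τ w (c w) ∈ Y
  unique : ∀ w ∈ U, w ∈ cotangentBundle ξ M → ∀ e, ξ (stepPos ξ V M τ w e) = 0 →
    stepPos ξ V M τ w e ∈ Y → e = c w

/-- The constraint `ξ(x¹) = 0` for the new position determines the position multiplier locally. -/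
lemma exists_isLocalMultiplier (hξ : ContDiff ℝ ∞ ξ) (hV : ContDiff ℝ 2 V) (hτ : τ ≠ 0)
    (hx : ∀ x ∈ levelSet ξ, IsUnit (crossGram ξ M x x).det) {z : Phase d}
    (hz : z ∈ cotangentBundle ξ M) {c₀ : Fin k → ℝ} (h0 : ξ (stepPos ξ V M τ z c₀) = 0)
    (hC : IsUnit (crossGram ξ M (stepPos ξ V M τ z c₀) z.1).det) :
    ∃ (U : Set (Phase d)) (Y : Set (Fin d → ℝ)) (c : Phase d → Fin k → ℝ),
      z ∈ U ∧ c z = c₀ ∧ IsLocalMultiplier ξ V M τ U Y c := by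
  have hξ1 : ContDiff ℝ 1 ξ := hξ.of_le (WithTop.coe_le_coe.2 le_top)
  have cdf : ContDiffAt ℝ 1 (fun q : Phase d × (Fin k → ℝ) => ξ (stepPos ξ V M τ q.1 q.2))
      (z, c₀) :=
    hξ1.contDiffAt.comp (z, c₀) (contDiffAt_stepPos hξ hV contDiffAt_fst contDiffAt_snd)
  obtain ⟨c, hcz, hcs, hc0, hev⟩ := exists_implicit_function cdf h0 (fun e he => by
    rw [fderiv_constraint_stepPos hξ z c₀ e (cdf.differentiableAt one_ne_zero)] at he
    exact Matrix.mulVec_injective_of_isUnit ((Matrix.isUnit_iff_isUnit_det _).2 hC)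
      (((smul_eq_zero_iff_right hτ).1 he).trans (Matrix.mulVec_zero _).symm))
  have hxz : IsUnit (crossGram ξ M z.1 z.1).det := hx _ (mem_cotangentBundle.1 hz).1
  -- The implicit function theorem gives uniqueness for multipliers near `c₀`. As `lambdaX` recovers
  -- the multiplier continuously from the position, this becomes uniqueness for new positions in an
  -- open set `Y`.
  have hℓ : ContinuousAt (fun q : Phase d × (Fin d → ℝ) =>
      (q.1, lambdaX ξ V M τ (fun _ => q.2) q.1)) (z, stepPos ξ V M τ z c₀) :=
    continuousAt_fst.prodMk (contDiffAt_lambdaX (f := Prod.fst) (y := Prod.snd)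
      (s := (z, stepPos ξ V M τ z c₀)) hξ hV contDiffAt_fst contDiffAt_snd hxz).continuousAt
  have hℓ0 : lambdaX ξ V M τ (fun _ => stepPos ξ V M τ z c₀) z = c₀ :=
    lambdaX_of_eq_stepPos hτ hxz rfl
  have hev2 := hℓ.eventually (p := fun v => ξ (stepPos ξ V M τ v.1 v.2) = 0 → v.2 = c v.1)
    (by simp only [hℓ0]; exact hev)
  rw [nhds_prod_eq, Filter.eventually_prod_iff] at hev2
  obtain ⟨pa, ha, pb, hb, hab⟩ := hev2
  obtain ⟨Y, hYb, hYo, hYz⟩ := eventually_nhds_iff.1 hb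
  have hyc : ContinuousAt (fun w => stepPos ξ V M τ w (c w)) z :=
    (contDiffAt_stepPos hξ hV contDiffAt_id hcs).continuousAt
  have h5 : ∀ᶠ w in nhds z, stepPos ξ V M τ w (c w) ∈ Y :=
    hyc.eventually (hYo.mem_nhds (by simpa only [hcz] using hYz))
  obtain ⟨U, hU, hUo, hUz⟩ := eventually_nhds_iff.1 (((ha.and h5).and
    (hcs.eventually (by simp))).and hc0)
  refine ⟨U, Y, c, hUz, hcz, hUo, hYo, fun w hw => (hU w hw).1.2, fun w hw => (hU w hw).2,
    fun w hw => (hU w hw).1.1.2, fun w hw hwT e he heY => ?_⟩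
  have h6 := hab (hU w hw).1.1.1 (hYb _ heY)
  rw [lambdaX_of_eq_stepPos hτ (hx _ (mem_cotangentBundle.1 hwT).1) (c := e) rfl] at h6
  exact h6 he


/-! ### The symplectic form under kicks and drifts -/

lemma dotProduct_fderiv_gradV_comm {φ : (Fin d → ℝ) → ℝ} (hφ : ContDiff ℝ 2 φ)
    (x a b : Fin d → ℝ) :
    a ⬝ᵥ fderiv ℝ (gradV φ) x b = b ⬝ᵥ fderiv ℝ (gradV φ) x a := by
  have hd : DifferentiableAt ℝ (fderiv ℝ φ) x :=
    ((hφ.fderiv_right (m := 1) (by norm_num)).differentiable one_ne_zero) x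
  have key : ∀ a b, a ⬝ᵥ fderiv ℝ (gradV φ) x b = fderiv ℝ (fderiv ℝ φ) x b a := by
    intro a b
    have h : HasFDerivAt (gradV φ) (ContinuousLinearMap.pi fun i =>
        (ContinuousLinearMap.apply ℝ ℝ (Pi.single i (1 : ℝ))).comp (fderiv ℝ (fderiv ℝ φ) x)) x :=
      hasFDerivAt_pi.2 fun i => by
        have h := (ContinuousLinearMap.apply ℝ ℝ
          (Pi.single i (1 : ℝ) : Fin d → ℝ)).hasFDerivAt.comp x hd.hasFDerivAt
        exact h
    rw [h.fderiv]
    conv_rhs => rw [pi_eq_sum_univ' a]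
    simp [map_sum, dotProduct]
  rw [key, key]
  exact hφ.contDiffAt.isSymmSndFDerivAt (by simp) b a

/-- For a frozen multiplier the constraint force is a gradient, so its derivative in `x` is a
symmetric Hessian. -/
lemma gradXi_mulVec_eq_gradV (hξ : ContDiff ℝ ∞ ξ) (x : Fin d → ℝ) (c : Fin k → ℝ) :
    gradXi ξ x *ᵥ c = gradV (fun y => c ⬝ᵥ ξ y) x := by
  ext i
  have hd : DifferentiableAt ℝ ξ x := hξ.differentiable (by simp) x
  have h : HasFDerivAt (fun y => c ⬝ᵥ ξ y) (∑ j, c j •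
      (ContinuousLinearMap.proj (R := ℝ) (φ := fun _ : Fin k => ℝ) j).comp (fderiv ℝ ξ x)) x := by
    simp only [dotProduct]
    exact HasFDerivAt.fun_sum fun j _ => ((hasFDerivAt_pi'.1 hd.hasFDerivAt j).const_mul (c j))
  rw [gradV, h.fderiv]
  simp [gradXi, Matrix.mulVec, dotProduct, mul_comm]

lemma fderiv_prod_apply {E F G : Type*} [NormedAddCommGroup E] [NormedSpace ℝ E]
    [NormedAddCommGroup F] [NormedSpace ℝ F] [NormedAddCommGroup G] [NormedSpace ℝ G]
    {f : E × F → G} {x : E} {y : F} (hf : DifferentiableAt ℝ f (x, y)) (u : E) (v : F) :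
    fderiv ℝ f (x, y) (u, v)
      = fderiv ℝ (fun a => f (a, y)) x u + fderiv ℝ (fun b => f (x, b)) y v := by
  have h1 : HasFDerivAt (fun a => f (a, y)) (fderiv ℝ f (x, y) ∘L .inl ℝ E F) x :=
    hf.hasFDerivAt.comp x (hasFDerivAt_prodMk_left x y)
  have h2 : HasFDerivAt (fun b => f (x, b)) (fderiv ℝ f (x, y) ∘L .inr ℝ E F) y :=
    hf.hasFDerivAt.comp y (hasFDerivAt_prodMk_right x y)
  rw [h1.fderiv, h2.fderiv]
  simp [← map_add]

lemma hasFDerivAt_gradXi_mulVec (hξ : ContDiff ℝ ∞ ξ) (x : Fin d → ℝ) (c : Fin k → ℝ) :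
    HasFDerivAt (fun q : (Fin d → ℝ) × (Fin k → ℝ) => gradXi ξ q.1 *ᵥ q.2)
      (fderiv ℝ (gradV fun y => c ⬝ᵥ ξ y) x ∘L .fst ℝ _ _ +
        (gradXi ξ x).mulVecLin.toContinuousLinearMap ∘L .snd ℝ _ _) (x, c) := by
  have hd : DifferentiableAt ℝ (fun q : (Fin d → ℝ) × (Fin k → ℝ) => gradXi ξ q.1 *ᵥ q.2) (x, c) :=
    (contDiffAt_gradXi_mulVec hξ contDiffAt_fst contDiffAt_snd).differentiableAt one_ne_zero
  convert hd.hasFDerivAt using 1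
  refine ContinuousLinearMap.ext fun q => ?_
  obtain ⟨u, e⟩ := q
  rw [fderiv_prod_apply hd]
  have h2 : fderiv ℝ (fun e => gradXi ξ x *ᵥ e) c
      = (gradXi ξ x).mulVecLin.toContinuousLinearMap :=
    (gradXi ξ x).mulVecLin.toContinuousLinearMap.fderiv
  have h1 : (fun a => gradXi ξ a *ᵥ c) = gradV fun y => c ⬝ᵥ ξ y :=
    funext fun a => gradXi_mulVec_eq_gradV hξ a c
  simp only [h1, h2]
  rfl

/-- The derivative of a constrained momentum update acts on positions by a symmetric matrix, up to
a term in the range of `∇ξ`. -/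
lemma exists_hasFDerivAt_kick (hξ : ContDiff ℝ ∞ ξ) (hV : ContDiff ℝ 2 V) (τ : ℝ)
    {E : Type*} [NormedAddCommGroup E] [NormedSpace ℝ E] {s : E} {f g : E → Fin d → ℝ}
    {c : E → Fin k → ℝ} {f' g' : E →L[ℝ] Fin d → ℝ} {c' : E →L[ℝ] Fin k → ℝ}
    (hf : HasFDerivAt f f' s) (hg : HasFDerivAt g g' s) (hc : HasFDerivAt c c' s) :
    ∃ T : (Fin d → ℝ) →L[ℝ] (Fin d → ℝ), (∀ a b, a ⬝ᵥ T b = b ⬝ᵥ T a) ∧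
      HasFDerivAt (fun w => g w - (τ / 2) • gradV V (f w) + gradXi ξ (f w) *ᵥ c w)
        (g' + T ∘L f' + (gradXi ξ (f s)).mulVecLin.toContinuousLinearMap ∘L c') s := by
  have hφ : ContDiff ℝ 2 fun y => c s ⬝ᵥ ξ y := by
    simp only [dotProduct]
    exact ContDiff.sum fun j _ => contDiff_const.mul
      (contDiff_pi.1 (hξ.of_le (WithTop.coe_le_coe.2 le_top)) j)
  -- The Hessian of `c·ξ - (τ/2) V` with `c` frozen at `c s`; the variation of `c` only contributes
  -- in the range of `∇ξ`.
  refine ⟨fderiv ℝ (gradV fun y => c s ⬝ᵥ ξ y) (f s) - (τ / 2) • fderiv ℝ (gradV V) (f s),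
    fun a b => ?_, ?_⟩
  · simp only [sub_apply, smul_apply, dotProduct_sub,
      dotProduct_smul]
    rw [dotProduct_fderiv_gradV_comm hV, dotProduct_fderiv_gradV_comm hφ]
  · have h1 : HasFDerivAt (fun w => gradV V (f w)) (fderiv ℝ (gradV V) (f s) ∘L f') s :=
      (((contDiff_gradV hV).differentiable one_ne_zero) (f s)).hasFDerivAt.comp s hf
    have h2 := (hasFDerivAt_gradXi_mulVec hξ (f s) (c s)).comp s (hf.prodMk hc)
    refine ((hg.sub (h1.const_smul (τ / 2))).add h2).congr_fderiv ?_
    ext1 v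
    simp
    abel

/-- The symmetric part cancels by antisymmetry of the form, and the range of `B` is orthogonal to
`a` and `b`. -/
lemma symplecticForm_kick {T : (Fin d → ℝ) →L[ℝ] (Fin d → ℝ)}
    (hT : ∀ a b, a ⬝ᵥ T b = b ⬝ᵥ T a) {B : Matrix (Fin d) (Fin k) ℝ} {a b : Fin d → ℝ}
    (ha : Bᵀ *ᵥ a = 0) (hb : Bᵀ *ᵥ b = 0) (p q : Fin d → ℝ) (c e : Fin k → ℝ) :
    symplecticForm (a, p + T a + B *ᵥ c) (b, q + T b + B *ᵥ e) = symplecticForm (a, p) (b, q) := by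
  simp only [symplecticForm, dotProduct_add, add_dotProduct]
  have h1 : a ⬝ᵥ (B *ᵥ e) = 0 := by
    rw [Matrix.dotProduct_mulVec, ← Matrix.mulVec_transpose, ha, zero_dotProduct]
  have h2 : (B *ᵥ c) ⬝ᵥ b = 0 := by
    rw [dotProduct_comm, Matrix.dotProduct_mulVec, ← Matrix.mulVec_transpose, hb, zero_dotProduct]
  rw [h1, h2, hT a b, dotProduct_comm b (T a)]
  ring

lemma inv_mulVec_dotProduct_comm (hM : M.PosDef) (p q : Fin d → ℝ) :
    (M⁻¹ *ᵥ p) ⬝ᵥ q = p ⬝ᵥ (M⁻¹ *ᵥ q) := by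
  have h : (M⁻¹)ᵀ = M⁻¹ := by
    rw [← Matrix.conjTranspose_eq_transpose_of_trivial]; exact hM.inv.1
  rw [Matrix.dotProduct_mulVec, ← Matrix.mulVec_transpose, h]

lemma symplecticForm_drift (hM : M.PosDef) (a b p q : Fin d → ℝ) :
    symplecticForm (a + τ • (M⁻¹ *ᵥ p), p) (b + τ • (M⁻¹ *ᵥ q), q)
      = symplecticForm (a, p) (b, q) := by
  simp only [symplecticForm, dotProduct_add, add_dotProduct, smul_dotProduct, dotProduct_smul,
    inv_mulVec_dotProduct_comm hM]
  ring

/-- The step with momentum reversal is antisymplectic on directions that preserve the constraints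
on the positions. -/
lemma exists_hasFDerivAt_mapF (hξ : ContDiff ℝ ∞ ξ) (hV : ContDiff ℝ 2 V) (hM : M.PosDef)
    {w : Phase d} {c e : Phase d → Fin k → ℝ} (hc : DifferentiableAt ℝ c w)
    (he : DifferentiableAt ℝ e w)
    (h0 : ∀ᶠ w' in nhds w, ξ (stepPos ξ V M τ w' (c w')) = 0) :
    ∃ D : Phase d →L[ℝ] Phase d, HasFDerivAt (fun w => mapF ξ V M τ w (c w) (e w)) D w ∧
      ∀ u v : Phase d, (gradXi ξ w.1)ᵀ *ᵥ u.1 = 0 → (gradXi ξ w.1)ᵀ *ᵥ v.1 = 0 →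
        symplecticForm (D u) (D v) = -symplecticForm u v := by
  obtain ⟨T, hT, hP⟩ := exists_hasFDerivAt_kick hξ hV τ (hasFDerivAt_fst (p := w))
    hasFDerivAt_snd hc.hasFDerivAt
  set P' := ContinuousLinearMap.snd ℝ (Fin d → ℝ) (Fin d → ℝ) + T ∘L .fst ℝ _ _ +
    (gradXi ξ w.1).mulVecLin.toContinuousLinearMap ∘L fderiv ℝ c w with hP'
  set X' := ContinuousLinearMap.fst ℝ (Fin d → ℝ) (Fin d → ℝ) +
    τ • (M⁻¹.mulVecLin.toContinuousLinearMap ∘L P') with hX'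
  -- The new position is the old one drifted by `τ M⁻¹` times the kicked momentum.
  have hX : HasFDerivAt (fun w => stepPos ξ V M τ w (c w)) X' w := by
    have h := (hasFDerivAt_fst (p := w)).add
      ((M⁻¹.mulVecLin.toContinuousLinearMap.hasFDerivAt.comp w hP).const_smul τ)
    refine h.congr_of_eventuallyEq (Filter.Eventually.of_forall fun w' => ?_)
    simp only [stepPos, Pi.add_apply, Pi.smul_apply, Function.comp_apply,
      LinearMap.coe_toContinuousLinearMap', Matrix.mulVecLin_apply, Matrix.mulVec_add,
      Matrix.mulVec_sub, Matrix.mulVec_smul]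
    module
  -- The constraint holds on a full ambient neighborhood, so every image direction is tangent to Σ
  -- at the new position; the second kick needs this.
  have hXv : ∀ v, (gradXi ξ (stepPos ξ V M τ w (c w)))ᵀ *ᵥ X' v = 0 := by
    intro v
    have hd := (hξ.differentiable (by simp) (stepPos ξ V M τ w (c w))).hasFDerivAt.comp w hX
    have hz : HasFDerivAt (fun w => ξ (stepPos ξ V M τ w (c w)))
        (0 : Phase d →L[ℝ] Fin k → ℝ) w :=
      (hasFDerivAt_const (0 : Fin k → ℝ) w).congr_of_eventuallyEq h0
    rw [← fderiv_apply_eq_gradXi]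
    exact congrArg (fun L : Phase d →L[ℝ] Fin k → ℝ => L v) (hd.unique hz)
  obtain ⟨T₂, hT₂, hP₂⟩ := exists_hasFDerivAt_kick hξ hV τ hX hP he.hasFDerivAt
  refine ⟨_, (hX.prodMk hP₂.neg).congr_of_eventuallyEq
    (Filter.Eventually.of_forall fun w' => Prod.ext rfl ?_), fun u v hu hv => ?_⟩
  · simp only [mapF, Pi.neg_apply, smul_add]
    congr 1
    abel
  · have hneg : ∀ a b p q : Fin d → ℝ, symplecticForm (a, -p) (b, -q)
        = -symplecticForm (a, p) (b, q) := by
      intro a b p q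
      simp only [symplecticForm, dotProduct_neg, neg_dotProduct]
      ring
    have h3 := symplecticForm_kick hT₂ (hXv u) (hXv v) (P' u) (P' v) (fderiv ℝ e w u)
      (fderiv ℝ e w v)
    have h2 := symplecticForm_drift (τ := τ) hM u.1 v.1 (P' u) (P' v)
    have h1 := symplecticForm_kick hT hu hv u.2 v.2 (fderiv ℝ c w u) (fderiv ℝ c w v)
    calc _ = -symplecticForm (X' u, P' u + T₂ (X' u) + gradXi ξ (stepPos ξ V M τ w (c w)) *ᵥ
              fderiv ℝ e w u) (X' v, P' v + T₂ (X' v) + gradXi ξ (stepPos ξ V M τ w (c w)) *ᵥ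
              fderiv ℝ e w v) := hneg _ _ _ _
      _ = -symplecticForm (X' u, P' u) (X' v, P' v) := by rw [h3]
      _ = -symplecticForm (u.1, P' u) (v.1, P' v) := congrArg _ h2
      _ = -symplecticForm u v := congrArg _ h1

/-! ### Tangent spaces of `T^*Σ` and Liouville volume -/

lemma fderiv_phaseConstraint (hξ : ContDiff ℝ ∞ ξ) (w : Phase d) :
    ∃ K : (Fin d → ℝ) →L[ℝ] (Fin k → ℝ), ∀ v, fderiv ℝ (phaseConstraint ξ M) w v
      = ((gradXi ξ w.1)ᵀ *ᵥ v.1, K v.1 + (gradXi ξ w.1)ᵀ *ᵥ (M⁻¹ *ᵥ v.2)) := by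
  have h2 : DifferentiableAt ℝ (fun w : Phase d => (gradXi ξ w.1)ᵀ *ᵥ (M⁻¹ *ᵥ w.2)) w :=
    (contDiffAt_gradXi_transpose_mulVec hξ contDiffAt_fst
      (contDiffAt_const_mulVec _ contDiffAt_snd)).differentiableAt one_ne_zero
  have h1 : HasFDerivAt (fun w : Phase d => ξ w.1) (fderiv ℝ ξ w.1 ∘L .fst ℝ _ _) w :=
    (hξ.differentiable (by simp) w.1).hasFDerivAt.comp w hasFDerivAt_fst
  refine ⟨fderiv ℝ (fun x => (gradXi ξ x)ᵀ *ᵥ (M⁻¹ *ᵥ w.2)) w.1, fun v => ?_⟩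
  have h : fderiv ℝ (phaseConstraint ξ M) w = _ := (h1.prodMk h2.hasFDerivAt).fderiv
  rw [h]
  refine Prod.ext (fderiv_apply_eq_gradXi _ _) ?_
  refine (fderiv_prod_apply (x := w.1) (y := w.2) h2 v.1 v.2).trans ?_
  congr 1
  exact congrArg (fun L : (Fin d → ℝ) →L[ℝ] (Fin k → ℝ) => L v.2)
    ((gradXi ξ w.1)ᵀ.mulVecLin.toContinuousLinearMap ∘L
      M⁻¹.mulVecLin.toContinuousLinearMap).fderiv

lemma contDiff_phaseConstraint (hξ : ContDiff ℝ ∞ ξ) : ContDiff ℝ 1 (phaseConstraint ξ M) :=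
  contDiff_iff_contDiffAt.2 fun _ =>
    ((hξ.of_le (WithTop.coe_le_coe.2 le_top)).contDiffAt.comp _ contDiffAt_fst).prodMk
      (contDiffAt_gradXi_transpose_mulVec hξ contDiffAt_fst
        (contDiffAt_const_mulVec _ contDiffAt_snd))

/-- The differential is block triangular: the position component is chosen first, then the momentum
absorbs the coupling `K`. -/
lemma range_fderiv_phaseConstraint (hξ : ContDiff ℝ ∞ ξ) {w : Phase d}
    (hw : IsUnit (crossGram ξ M w.1 w.1).det) :
    (fderiv ℝ (phaseConstraint ξ M) w).range = ⊤ := by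
  obtain ⟨K, hK⟩ := fderiv_phaseConstraint (M := M) hξ w
  refine LinearMap.range_eq_top.2 fun rs => ?_
  obtain ⟨r, s⟩ := rs
  set u := M⁻¹ *ᵥ (gradXi ξ w.1 *ᵥ ((crossGram ξ M w.1 w.1)⁻¹ *ᵥ r))
  refine ⟨(u, gradXi ξ w.1 *ᵥ ((crossGram ξ M w.1 w.1)⁻¹ *ᵥ (s - K u))), ?_⟩
  refine (hK _).trans (Prod.ext ?_ ?_)
  · exact (crossGram_mulVec _ _ _).symm.trans (mulVec_inv_mulVec hw r)
  · simp only
    rw [← crossGram_mulVec, mulVec_inv_mulVec hw, add_sub_cancel]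

/-- The symplectic form is nondegenerate on the tangent spaces of `T^*Σ`. -/
lemma eq_zero_of_symplecticForm_eq_zero (hξ : ContDiff ℝ ∞ ξ) (hM : M.PosDef) {w : Phase d}
    (hw : IsUnit (crossGram ξ M w.1 w.1).det) {u : Phase d} (hu : u ∈ tangentSpaceAt ξ M w)
    (h : ∀ v ∈ tangentSpaceAt ξ M w, symplecticForm v u = 0) : u = 0 := by
  obtain ⟨K, hK⟩ := fderiv_phaseConstraint (M := M) hξ w
  have hmem : ∀ v : Phase d, v ∈ tangentSpaceAt ξ M w ↔ (gradXi ξ w.1)ᵀ *ᵥ v.1 = 0 ∧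
      K v.1 + (gradXi ξ w.1)ᵀ *ᵥ (M⁻¹ *ᵥ v.2) = 0 := fun v =>
    LinearMap.mem_ker.trans ((Eq.congr_left (hK v)).trans Prod.mk_eq_zero)
  have hMu : IsUnit M.det := (Matrix.isUnit_iff_isUnit_det _).1 hM.isUnit
  obtain ⟨hu1, hu2⟩ := (hmem u).1 hu
  have hx : u.1 = 0 := by
    -- A vertical test vector, tangent because `u.1` is; the pairing becomes `-(M u.1)·u.1`.
    have h1 := h (0, M *ᵥ u.1) ((hmem _).2 ⟨Matrix.mulVec_zero _, by
      simp only [map_zero, zero_add, inv_mulVec_mulVec hMu, hu1]⟩)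
    simp only [symplecticForm, zero_dotProduct, zero_sub, neg_eq_zero] at h1
    by_contra hne
    have := hM.dotProduct_mulVec_pos hne
    rw [star_trivial, dotProduct_comm, h1] at this
    exact lt_irrefl _ this
  rw [hx, map_zero, zero_add] at hu2
  have hp : u.2 = 0 := by
    -- The momentum entry only makes the test vector tangent; it pairs with `u.1 = 0` and drops out.
    have h1 := h (M⁻¹ *ᵥ u.2, -(gradXi ξ w.1 *ᵥ ((crossGram ξ M w.1 w.1)⁻¹ *ᵥ
      K (M⁻¹ *ᵥ u.2)))) ((hmem _).2 ⟨hu2, by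
        simp only
        rw [Matrix.mulVec_neg, Matrix.mulVec_neg, ← crossGram_mulVec, mulVec_inv_mulVec hw,
          add_neg_cancel]⟩)
    simp only [symplecticForm, hx, dotProduct_zero, sub_zero] at h1
    by_contra hne
    have := hM.inv.dotProduct_mulVec_pos hne
    rw [star_trivial, dotProduct_comm, h1] at this
    exact lt_irrefl _ this
  exact Prod.ext hx hp

/-- A kernel vector of the Gram matrix would give a nonzero vector of `T` in the radical of the
form. -/
lemma liouvilleVolume_finBasis_ne_zero {T : Submodule ℝ (Phase d)}
    (hT : ∀ u ∈ T, (∀ v ∈ T, symplecticForm v u = 0) → u = 0) :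
    liouvilleVolume (fun i => (Module.finBasis ℝ T i : Phase d)) ≠ 0 := by
  set b := Module.finBasis ℝ T
  intro h0
  have hdet : (Matrix.of fun i j => symplecticForm (b i : Phase d) (b j : Phase d)).det = 0 := by
    rw [liouvilleVolume, Real.sqrt_eq_zero (abs_nonneg _), abs_eq_zero] at h0
    exact h0
  obtain ⟨a, ha, hav⟩ := Matrix.exists_mulVec_eq_zero_iff.2 hdet
  have hu : (∑ j, a j • (b j : Phase d)) = 0 := by
    refine hT _ (Submodule.sum_mem _ fun j _ => T.smul_mem _ (b j).2) fun v hv => ?_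
    have hvb : v = ∑ i, b.repr ⟨v, hv⟩ i • (b i : Phase d) := by
      have h := congrArg T.subtype (b.sum_repr ⟨v, hv⟩)
      rw [map_sum] at h
      simpa only [map_smul, Submodule.subtype_apply] using h.symm
    rw [hvb, symplecticForm_sum]
    simp only [Finset.sum_mul]
    rw [Finset.sum_comm]
    refine Finset.sum_eq_zero fun i _ => ?_
    have h := congrFun hav i
    simp only [Matrix.mulVec, dotProduct, Matrix.of_apply, Pi.zero_apply] at h
    simp only [mul_assoc]
    rw [← Finset.mul_sum, h, mul_zero]
  refine ha (funext fun j => ?_)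
  refine Fintype.linearIndependent_iff.1 b.linearIndependent a (Subtype.ext ?_) j
  simpa using hu

lemma liouvilleAbsDet_eq_one_of_antisymplectic {T : Submodule ℝ (Phase d)}
    (hT : ∀ u ∈ T, (∀ v ∈ T, symplecticForm v u = 0) → u = 0) {D : Phase d →L[ℝ] Phase d}
    (hD : ∀ u ∈ T, ∀ v ∈ T, symplecticForm (D u) (D v) = -symplecticForm u v) :
    liouvilleAbsDet T D = 1 := by
  rw [liouvilleAbsDet, div_eq_one_iff_eq (liouvilleVolume_finBasis_ne_zero hT)]
  rw [liouvilleVolume, liouvilleVolume]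
  congr 1
  have h : (Matrix.of fun i j => symplecticForm (D (Module.finBasis ℝ T i : Phase d))
      (D (Module.finBasis ℝ T j : Phase d))) = -(Matrix.of fun i j =>
      symplecticForm (Module.finBasis ℝ T i : Phase d) (Module.finBasis ℝ T j : Phase d)) := by
    ext i j
    exact hD _ (Module.finBasis ℝ T i).2 _ (Module.finBasis ℝ T j).2
  rw [h, Matrix.det_neg, abs_mul, abs_pow, abs_neg, abs_one, one_pow, one_mul]

/-- Derivatives along `T^*Σ` are determined on the tangent space. -/
lemma hasFDerivWithinAt_unique_on_tangentSpace (hξ : ContDiff ℝ ∞ ξ) {w : Phase d}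
    (hw : IsUnit (crossGram ξ M w.1 w.1).det) (hwT : w ∈ cotangentBundle ξ M)
    {f : Phase d → Phase d} {U : Set (Phase d)} (hU : IsOpen U) (hwU : w ∈ U)
    {D D' : Phase d →L[ℝ] Phase d}
    (h : HasFDerivWithinAt f D (cotangentBundle ξ M ∩ U) w)
    (h' : HasFDerivWithinAt f D' (cotangentBundle ξ M ∩ U) w)
    {v : Phase d} (hv : v ∈ tangentSpaceAt ξ M w) : D v = D' v := by
  have hs := (contDiff_phaseConstraint (M := M) hξ).contDiffAt.hasStrictFDerivAt
    (x := w) one_ne_zero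
  have hr := range_fderiv_phaseConstraint hξ hw
  -- `φ` parametrizes the level set near `w` by the tangent space, with derivative the inclusion at
  -- 0. Hence `f ∘ φ` has an ordinary, unique derivative there.
  set φ := hs.implicitFunction _ _ hr (phaseConstraint ξ M w) with hφ
  have hφ0 : φ 0 = w := hs.implicitFunction_apply_image hr
  have hφd := (hs.to_implicitFunction hr).hasFDerivAt
  have hφU : ∀ᶠ y in nhds 0, φ y ∈ U :=
    hφd.continuousAt.eventually (by rw [← hφ, hφ0]; exact hU.mem_nhds hwU)
  have hφT : ∀ᶠ y in nhds 0, φ y ∈ cotangentBundle ξ M := by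
    have h1 := (hs.map_implicitFunction_eq hr)
    have h2 : Filter.Tendsto (fun y : (fderiv ℝ (phaseConstraint ξ M) w).ker =>
        (phaseConstraint ξ M w, y)) (nhds 0) (nhds (phaseConstraint ξ M w, 0)) :=
      (continuous_const.prodMk continuous_id).tendsto' _ _ rfl
    filter_upwards [h2.eventually h1] with y hy
    exact hy.trans hwT
  have hev : ∀ᶠ y in nhds 0, φ y ∈ cotangentBundle ξ M ∩ U := hφT.and hφU
  have key : ∀ {L : Phase d →L[ℝ] Phase d},
      HasFDerivWithinAt f L (cotangentBundle ξ M ∩ U) w → HasFDerivAt (f ∘ φ) (L ∘L _) 0 :=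
    fun hL => ((hφ0.symm ▸ hL : HasFDerivWithinAt f _ (cotangentBundle ξ M ∩ U) (φ 0)).comp 0
      (t := cotangentBundle ξ M ∩ U) (hφd.hasFDerivWithinAt (s := φ ⁻¹' _))
      fun _ hy => hy).hasFDerivAt hev
  exact congrArg (fun L : (fderiv ℝ (phaseConstraint ξ M) w).ker →L[ℝ] Phase d => L ⟨v, hv⟩)
    ((key h).unique (key h'))


/-! ### Uniqueness on connected sets and `C¹` maps -/

/-- The agreement set is closed since `Z` is Hausdorff, and open since it equals the preimage of `W`
under `f`. -/
lemma eqOn_of_isPreconnected {X Z : Type*} [TopologicalSpace X] [TopologicalSpace Z] [T2Space Z]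
    {S : Set X} (hS : IsPreconnected S) {f g : X → Z} (hf : ContinuousOn f S)
    (hg : ContinuousOn g S) {W : Set Z} (hW : IsOpen W) (hgW : Set.MapsTo g S W)
    (h : ∀ x ∈ S, f x ∈ W → f x = g x) {z : X} (hz : z ∈ S) (hfz : f z = g z) :
    Set.EqOn f g S := by
  have := isPreconnected_iff_preconnectedSpace.1 hS
  have hf' := continuousOn_iff_continuous_domRestrict.1 hf
  have hg' := continuousOn_iff_continuous_domRestrict.1 hg
  have e : {x : S | S.domRestrict f x = S.domRestrict g x} = S.domRestrict f ⁻¹' W := by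
    ext x
    exact ⟨fun hx => by rw [Set.mem_preimage, show S.domRestrict f x = S.domRestrict g x from hx]
                        exact hgW x.2, fun hx => h x x.2 hx⟩
  have hc : IsClopen {x : S | S.domRestrict f x = S.domRestrict g x} :=
    ⟨isClosed_eq hf' hg', e ▸ hW.preimage hf'⟩
  have hu := hc.eq_univ ⟨⟨z, hz⟩, hfz⟩
  intro x hx
  have : (⟨x, hx⟩ : S) ∈ {x : S | S.domRestrict f x = S.domRestrict g x} := hu ▸ Set.mem_univ _
  exact this

section C1

variable {Z W : Type*} [NormedAddCommGroup Z] [NormedSpace ℝ Z] [NormedAddCommGroup W]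
  [NormedSpace ℝ W] {f g : Z → W} {O : Set Z}

lemma IsC1On.continuousOn (h : IsC1On f O) : ContinuousOn f O := by
  intro w hw
  obtain ⟨U, hU, hwU, g, hg, hfg⟩ := h w hw
  have h1 : ContinuousWithinAt f (O ∩ U) w :=
    ((hg.continuousOn w hwU).mono Set.inter_subset_right).congr hfg (hfg ⟨hw, hwU⟩)
  exact (continuousWithinAt_inter (hU.mem_nhds hwU)).1 h1

lemma isC1On_of_eqOn (hg : ∀ w ∈ O, ContDiffAt ℝ 1 g w) (hfg : Set.EqOn f g O) : IsC1On f O := by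
  intro w hw
  obtain ⟨U, hU, hUo, hwU⟩ := eventually_nhds_iff.1 ((hg w hw).eventually (by simp))
  exact ⟨U, hUo, hwU, g, fun y hy => (hU y hy).contDiffWithinAt, hfg.mono Set.inter_subset_left⟩

end C1

/-! ### Branches of the step and their inverses -/

/-- The step of the scheme with position multiplier `c`, the momentum multiplier being determined
by the constraint. -/
noncomputable def branch (ξ : (Fin d → ℝ) → (Fin k → ℝ)) (V : (Fin d → ℝ) → ℝ)
    (M : Matrix (Fin d) (Fin d) ℝ) (τ : ℝ) (c : Phase d → Fin k → ℝ) (w : Phase d) : Phase d :=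
  mapF ξ V M τ w (c w) (momMult ξ V M τ w (c w))

namespace IsLocalMultiplier

variable {U U' : Set (Phase d)} {Y Y' : Set (Fin d → ℝ)} {c c' : Phase d → Fin k → ℝ} {w : Phase d}

lemma branch_mem (h : IsLocalMultiplier ξ V M τ U Y c)
    (hx : ∀ x ∈ levelSet ξ, IsUnit (crossGram ξ M x x).det) (hw : w ∈ U) :
    branch ξ V M τ c w ∈ cotangentBundle ξ M :=
  (mapF_mem_cotangentBundle_iff (hx _)).2 ⟨h.constraint w hw, rfl⟩

lemma contDiffAt_stepPos (h : IsLocalMultiplier ξ V M τ U Y c) (hξ : ContDiff ℝ ∞ ξ)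
    (hV : ContDiff ℝ 2 V) (hw : w ∈ U) :
    ContDiffAt ℝ 1 (fun w => stepPos ξ V M τ w (c w)) w :=
  RattleScheme.contDiffAt_stepPos hξ hV contDiffAt_id (h.contDiffAt w hw)

lemma contDiffAt_momMult (h : IsLocalMultiplier ξ V M τ U Y c) (hξ : ContDiff ℝ ∞ ξ)
    (hV : ContDiff ℝ 2 V) (hx : ∀ x ∈ levelSet ξ, IsUnit (crossGram ξ M x x).det) (hw : w ∈ U) :
    ContDiffAt ℝ 1 (fun w => momMult ξ V M τ w (c w)) w :=
  RattleScheme.contDiffAt_momMult hξ hV contDiffAt_id (h.contDiffAt w hw)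
    (hx _ (h.constraint w hw))

lemma contDiffAt_branch (h : IsLocalMultiplier ξ V M τ U Y c) (hξ : ContDiff ℝ ∞ ξ)
    (hV : ContDiff ℝ 2 V) (hx : ∀ x ∈ levelSet ξ, IsUnit (crossGram ξ M x x).det) (hw : w ∈ U) :
    ContDiffAt ℝ 1 (branch ξ V M τ c) w :=
  contDiffAt_mapF hξ hV contDiffAt_id (h.contDiffAt w hw) (h.contDiffAt_momMult hξ hV hx hw)

lemma eq_of_mapF_mem (h : IsLocalMultiplier ξ V M τ U Y c)
    (hx : ∀ x ∈ levelSet ξ, IsUnit (crossGram ξ M x x).det) (hw : w ∈ U)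
    (hwT : w ∈ cotangentBundle ξ M) {a b : Fin k → ℝ}
    (hab : mapF ξ V M τ w a b ∈ cotangentBundle ξ M) (hY : stepPos ξ V M τ w a ∈ Y) :
    a = c w ∧ b = momMult ξ V M τ w (c w) := by
  obtain ⟨h1, h2⟩ := (mapF_mem_cotangentBundle_iff (hx _)).1 hab
  have h3 := h.unique w hw hwT a h1 hY
  exact ⟨h3, h3 ▸ h2⟩

/-- The exchanged multipliers lead from the image back to `w`; as `w.1 ∈ Y'`, local uniqueness
identifies them with those of `c'`. -/
lemma branch_branch (h' : IsLocalMultiplier ξ V M τ U' Y' c')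
    (hx : ∀ x ∈ levelSet ξ, IsUnit (crossGram ξ M x x).det)
    (hwT : w ∈ cotangentBundle ξ M) (hb : branch ξ V M τ c w ∈ cotangentBundle ξ M)
    (hU' : branch ξ V M τ c w ∈ U') (hY' : w.1 ∈ Y') :
    branch ξ V M τ c' (branch ξ V M τ c w) = w := by
  have h1 : mapF ξ V M τ (branch ξ V M τ c w) (momMult ξ V M τ w (c w)) (c w) = w := mapF_mapF _ _ _
  obtain ⟨h2, h3⟩ := h'.eq_of_mapF_mem hx hU' hb (h1.symm ▸ hwT)
    ((congrArg Prod.fst h1).symm ▸ hY' :)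
  conv_rhs => rw [← h1]
  rw [h2, h3]
  rfl

/-- The initial states near which the branches of `c` and `c'` are inverse to each other. -/
def reversibleSet (ξ : (Fin d → ℝ) → (Fin k → ℝ)) (V : (Fin d → ℝ) → ℝ)
    (M : Matrix (Fin d) (Fin d) ℝ) (τ : ℝ) (U U' : Set (Phase d)) (Y' : Set (Fin d → ℝ))
    (c : Phase d → Fin k → ℝ) : Set (Phase d) :=
  (U ∩ branch ξ V M τ c ⁻¹' U') ∩ Prod.fst ⁻¹' Y'

lemma isOpen_reversibleSet (h : IsLocalMultiplier ξ V M τ U Y c)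
    (h' : IsLocalMultiplier ξ V M τ U' Y' c') (hξ : ContDiff ℝ ∞ ξ)
    (hV : ContDiff ℝ 2 V) (hx : ∀ x ∈ levelSet ξ, IsUnit (crossGram ξ M x x).det) :
    IsOpen (reversibleSet ξ V M τ U U' Y' c) :=
  (ContinuousOn.isOpen_inter_preimage (fun _ hw =>
    (h.contDiffAt_branch hξ hV hx hw).continuousAt.continuousWithinAt)
    h.isOpen_domain h'.isOpen_domain).inter (h'.isOpen_target.preimage continuous_fst)

lemma branch_mapsTo (h : IsLocalMultiplier ξ V M τ U Y c)
    (h' : IsLocalMultiplier ξ V M τ U' Y' c')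
    (hx : ∀ x ∈ levelSet ξ, IsUnit (crossGram ξ M x x).det)
    (hw : w ∈ cotangentBundle ξ M ∩ reversibleSet ξ V M τ U U' Y' c) :
    branch ξ V M τ c w ∈ cotangentBundle ξ M ∩ reversibleSet ξ V M τ U' U Y c' ∧
      branch ξ V M τ c' (branch ξ V M τ c w) = w := by
  obtain ⟨hwT, ⟨hwU, hwU'⟩, hwY⟩ := hw
  have hb := h.branch_mem hx hwU
  have e := h'.branch_branch hx hwT hb hwU' hwY
  exact ⟨⟨hb, ⟨hwU', by rwa [Set.mem_preimage, e]⟩, h.mem_target w hwU⟩, e⟩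

/-- Surjectivity is `branch_mapsTo` with the branches exchanged, so the image is visibly relatively
open. -/
lemma branch_image (h : IsLocalMultiplier ξ V M τ U Y c)
    (h' : IsLocalMultiplier ξ V M τ U' Y' c')
    (hx : ∀ x ∈ levelSet ξ, IsUnit (crossGram ξ M x x).det) :
    branch ξ V M τ c '' (cotangentBundle ξ M ∩ reversibleSet ξ V M τ U U' Y' c)
      = cotangentBundle ξ M ∩ reversibleSet ξ V M τ U' U Y c' := by
  ext w
  constructor
  · rintro ⟨w, hw, rfl⟩
    exact (h.branch_mapsTo h' hx hw).1
  · intro hw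
    have := h'.branch_mapsTo h hx hw
    exact ⟨_, this.1, this.2⟩

end IsLocalMultiplier

end RattleScheme

/-! ### Proof of the proposition -/

theorem mainTheorem5 {d k : ℕ} (hk : 1 ≤ k) (hkd : k < d)
    (ξ : (Fin d → ℝ) → (Fin k → ℝ)) (Vbar : (Fin d → ℝ) → ℝ)
    (M : Matrix (Fin d) (Fin d) ℝ) (τ : ℝ)
    (hξ : ContDiff ℝ ∞ ξ) (hV : ContDiff ℝ 2 Vbar)
    (hcompact : IsCompact (levelSet ξ))
    (hrank : ∀ x ∈ levelSet ξ, ((gradXi ξ x)ᵀ * gradXi ξ x).PosDef)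
    (hM : M.PosDef) (hτ : 0 < τ)
    (z z' : Phase d) (hz : z ∈ cotangentBundle ξ M)
    (hz' : z' ∈ outcomes ξ Vbar M τ z) (hC : z'.1 ∉ criticalSet ξ M z.1) :
    ∃ (O : Set (Phase d)) (Υ₁ : Phase d → (Fin d → ℝ)),
      -- the position map and its uniqueness
      (IsNeighborhoodIn (cotangentBundle ξ M) O z ∧
        IsC1On Υ₁ O ∧ Set.MapsTo Υ₁ O (levelSet ξ) ∧ Υ₁ z = z'.1 ∧
        (∀ w ∈ O, mapG ξ Vbar M τ w.1 (Υ₁ w) = w.2) ∧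
        ∀ (O' : Set (Phase d)) (Υ₁' : Phase d → (Fin d → ℝ)),
          IsNeighborhoodIn (cotangentBundle ξ M) O' z →
          IsC1On Υ₁' O' → Set.MapsTo Υ₁' O' (levelSet ξ) → Υ₁' z = z'.1 →
          (∀ w ∈ O', mapG ξ Vbar M τ w.1 (Υ₁' w) = w.2) →
          Set.EqOn Υ₁' Υ₁ (connectedComponentIn (O ∩ O') z)) ∧
      -- the Lagrange multiplier functions and their uniqueness
      (IsC1On (lambdaX ξ Vbar M τ Υ₁) O ∧ IsC1On (lambdaP ξ Vbar M τ Υ₁) O ∧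
        z' = mapF ξ Vbar M τ z (lambdaX ξ Vbar M τ Υ₁ z) (lambdaP ξ Vbar M τ Υ₁ z) ∧
        (∀ w ∈ O, mapF ξ Vbar M τ w (lambdaX ξ Vbar M τ Υ₁ w) (lambdaP ξ Vbar M τ Υ₁ w)
          ∈ outcomes ξ Vbar M τ w) ∧
        ∀ (O' : Set (Phase d)) (lx lp : Phase d → (Fin k → ℝ)),
          IsNeighborhoodIn (cotangentBundle ξ M) O' z →
          IsC1On lx O' → IsC1On lp O' → z' = mapF ξ Vbar M τ z (lx z) (lp z) →
          (∀ w ∈ O', mapF ξ Vbar M τ w (lx w) (lp w) ∈ outcomes ξ Vbar M τ w) →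
          Set.EqOn lx (lambdaX ξ Vbar M τ Υ₁) (connectedComponentIn (O ∩ O') z) ∧
          Set.EqOn lp (lambdaP ξ Vbar M τ Υ₁) (connectedComponentIn (O ∩ O') z)) ∧
      -- the one-step map as a volume-preserving local diffeomorphism
      ∃ Q : Set (Phase d), Q ⊆ O ∧ IsNeighborhoodIn (cotangentBundle ξ M) Q z ∧
        IsC1DiffeoOnto (rattleMap ξ Vbar M τ Υ₁) Q ∧
        rattleMap ξ Vbar M τ Υ₁ z = z' ∧
        IsNeighborhoodIn (cotangentBundle ξ M) (rattleMap ξ Vbar M τ Υ₁ '' Q) z' ∧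
        (∀ w ∈ Q, HasAbsDetOn ξ M (rattleMap ξ Vbar M τ Υ₁) Q w 1) ∧
        ∀ w ∈ Q, outcomes ξ Vbar M τ w ∩ rattleMap ξ Vbar M τ Υ₁ '' Q
          = {rattleMap ξ Vbar M τ Υ₁ w} := by
  have hx : ∀ x ∈ levelSet ξ, IsUnit (crossGram ξ M x x).det := fun x h =>
    isUnit_det_crossGram_self hM (hrank x h)
  have hMu : IsUnit M.det := (Matrix.isUnit_iff_isUnit_det _).1 hM.isUnit
  have hτ0 : τ ≠ 0 := hτ.ne'
  obtain ⟨hz'T, c₀, e₀, hz'eq⟩ := hz'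
  have hy : z'.1 = stepPos ξ Vbar M τ z c₀ := congrArg Prod.fst hz'eq
  have hz'0 : ξ z'.1 = 0 := (mem_cotangentBundle.1 hz'T).1
  have hdet : IsUnit (crossGram ξ M z'.1 z.1).det :=
    isUnit_iff_ne_zero.2 fun h => hC ⟨hz'0, h⟩
  obtain ⟨U, Y, c, hzU, hcz, h⟩ := exists_isLocalMultiplier hξ hV hτ0 hx hz
    (c₀ := c₀) (hy ▸ hz'0) (hy ▸ hdet)
  have hrev : mapF ξ Vbar M τ z' e₀ c₀ = z := by rw [hz'eq, mapF_mapF]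
  have hxz : stepPos ξ Vbar M τ z' e₀ = z.1 := congrArg Prod.fst hrev
  -- The reversed step from `z'` has multiplier `e₀` and ends at `z.1`; its cross Gram matrix is the
  -- transpose of the given invertible one.
  obtain ⟨U', Y', c', hzU', hcz', h'⟩ := exists_isLocalMultiplier hξ hV hτ0 hx hz'T
    (c₀ := e₀) (by rw [hxz]; exact (mem_cotangentBundle.1 hz).1)
    (by rw [hxz, ← crossGram_transpose hM, Matrix.det_transpose]; exact hdet)
  set Υ₁ : Phase d → (Fin d → ℝ) := fun w => stepPos ξ Vbar M τ w (c w) with hΥ₁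
  set O := cotangentBundle ξ M ∩ U with hO
  have hgram : ∀ w ∈ cotangentBundle ξ M, IsUnit (crossGram ξ M w.1 w.1).det := fun w hw =>
    hx _ (mem_cotangentBundle.1 hw).1
  have hlx : Set.EqOn (lambdaX ξ Vbar M τ Υ₁) c O := fun w hw =>
    lambdaX_of_eq_stepPos hτ0 (hgram w hw.1) rfl
  have hlp : Set.EqOn (lambdaP ξ Vbar M τ Υ₁) (fun w => momMult ξ Vbar M τ w (c w)) O :=
    fun w hw => lambdaP_of_eq_stepPos (hlx hw) rfl
  have hmap : Set.EqOn (rattleMap ξ Vbar M τ Υ₁) (branch ξ Vbar M τ c) O := fun w hw => by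
    simp only [rattleMap, branch, hlx hw, hlp hw]
  have hzO : z ∈ O := ⟨hz, hzU⟩
  have hO1 : IsC1On Υ₁ O :=
    isC1On_of_eqOn (fun w hw => h.contDiffAt_stepPos hξ hV hw.2) fun _ _ => rfl
  have hΥz : Υ₁ z = z'.1 := by simp only [hΥ₁, hcz, hy]
  have hbz : branch ξ Vbar M τ c z = z' := by
    obtain ⟨h1, h2⟩ := h.eq_of_mapF_mem hx hzU hz (hz'eq ▸ hz'T)
      (by rw [← hcz]; exact h.mem_target z hzU)
    rw [hz'eq, h2, h1]
    rfl
  -- Common to both uniqueness claims; a competing position map need only be continuous.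
  have huniq : ∀ (O' : Set (Phase d)) (Υ₁' : Phase d → (Fin d → ℝ)), z ∈ O' →
      ContinuousOn Υ₁' O' → Υ₁' z = z'.1 →
      (∀ w ∈ O ∩ O', ξ (Υ₁' w) = 0 ∧ ∃ e, Υ₁' w = stepPos ξ Vbar M τ w e) →
      Set.EqOn Υ₁' Υ₁ (connectedComponentIn (O ∩ O') z) := by
    intro O' Υ₁' hzO' hcont hΥ' hsol
    have hsub := connectedComponentIn_subset (O ∩ O') z
    refine eqOn_of_isPreconnected isPreconnected_connectedComponentIn
      (hcont.mono fun w hw => (hsub hw).2) (hO1.continuousOn.mono fun w hw => (hsub hw).1)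
      h.isOpen_target (fun w hw => h.mem_target w (hsub hw).1.2) (fun w hw hwY => ?_)
      (mem_connectedComponentIn ⟨hzO, hzO'⟩) (hΥ'.trans hΥz.symm)
    obtain ⟨h0, e, he⟩ := hsol w (hsub hw)
    rw [he] at h0 hwY ⊢
    rw [h.unique w (hsub hw).1.2 (hsub hw).1.1 e h0 hwY]
  refine ⟨O, Υ₁, ⟨⟨hzO, U, h.isOpen_domain, rfl⟩, hO1, fun w hw => h.constraint w hw.2, hΥz,
    fun w hw => (mapG_eq_iff hMu hτ0 (hgram w hw.1) hw.1 _).2 ⟨_, rfl⟩, ?_⟩,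
    ⟨isC1On_of_eqOn (fun w hw => h.contDiffAt w hw.2) hlx,
      isC1On_of_eqOn (fun w hw => h.contDiffAt_momMult hξ hV hx hw.2) hlp,
      (hbz.symm.trans (hmap hzO).symm :),
      fun w hw => ⟨(congrArg (· ∈ cotangentBundle ξ M) (hmap hw)).mpr (h.branch_mem hx hw.2),
        _, _, rfl⟩, ?_⟩, ?_⟩
  · intro O' Υ₁' hO' hC1 hlev hΥ' hG
    exact huniq O' Υ₁' hO'.1 hC1.continuousOn hΥ' fun w hw =>
      ⟨hlev hw.2, (mapG_eq_iff hMu hτ0 (hgram w hw.1.1) hw.1.1 _).1 (hG w hw.2)⟩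
  · intro O' lx lp hO' hlx1 _ hzeq hout
    have hmem : ∀ w ∈ O', ξ (stepPos ξ Vbar M τ w (lx w)) = 0 ∧
        lp w = momMult ξ Vbar M τ w (lx w) := fun w hw =>
      (mapF_mem_cotangentBundle_iff (hx _)).1 (hout w hw).1
    have hstep : ContinuousOn (fun w => stepPos ξ Vbar M τ w (lx w)) O' := by
      have hq : Continuous fun q : Phase d × (Fin k → ℝ) => stepPos ξ Vbar M τ q.1 q.2 :=
        continuous_iff_continuousAt.2 fun _ =>
          (contDiffAt_stepPos hξ hV contDiffAt_fst contDiffAt_snd).continuousAt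
      exact hq.comp_continuousOn (continuousOn_id.prodMk hlx1.continuousOn)
    have heq := huniq O' _ hO'.1 hstep (congrArg Prod.fst hzeq).symm
      fun w hw => ⟨(hmem w hw.2).1, lx w, rfl⟩
    have hsub := connectedComponentIn_subset (O ∩ O') z
    have hX : Set.EqOn lx c (connectedComponentIn (O ∩ O') z) := fun w hw =>
      h.unique w (hsub hw).1.2 (hsub hw).1.1 _ (hmem w (hsub hw).2).1
        ((congrArg (· ∈ Y) (heq hw)).mpr (h.mem_target w (hsub hw).1.2))
    refine ⟨fun w hw => (hX hw).trans (hlx (hsub hw).1).symm, fun w hw => ?_⟩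
    rw [hlp (hsub hw).1, (hmem w (hsub hw).2).2, hX hw]
  · set R := IsLocalMultiplier.reversibleSet ξ Vbar M τ U U' Y' c with hR
    have hRo : IsOpen R := h.isOpen_reversibleSet h' hξ hV hx
    have hQO : cotangentBundle ξ M ∩ R ⊆ O := fun w hw => ⟨hw.1, hw.2.1.1⟩
    have himg : rattleMap ξ Vbar M τ Υ₁ '' (cotangentBundle ξ M ∩ R)
        = cotangentBundle ξ M ∩ IsLocalMultiplier.reversibleSet ξ Vbar M τ U' U Y c' := by
      rw [(hmap.mono hQO).image_eq, h.branch_image h' hx]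
    have hzQ : z ∈ cotangentBundle ξ M ∩ R :=
      ⟨hz, ⟨hzU, by rw [Set.mem_preimage, hbz]; exact hzU'⟩, by
        have := h'.mem_target z' hzU'
        rwa [hcz', hxz] at this⟩
    refine ⟨cotangentBundle ξ M ∩ R, hQO, ⟨hzQ, R, hRo, rfl⟩,
      ⟨isC1On_of_eqOn (fun w hw => h.contDiffAt_branch hξ hV hx (hQO hw).2) (hmap.mono hQO),
        branch ξ Vbar M τ c', ?_, fun w hw => ?_⟩, (hmap hzO).trans hbz, ?_, fun w hw => ?_,
      fun w hw => ?_⟩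
    · rw [himg]
      exact isC1On_of_eqOn (fun w hw => h'.contDiffAt_branch hξ hV hx hw.2.1.1) fun _ _ => rfl
    · rw [hmap (hQO hw)]
      exact (h.branch_mapsTo h' hx hw).2
    · refine ⟨⟨z, hzQ, (hmap hzO).trans hbz⟩, _, h'.isOpen_reversibleSet h hξ hV hx, himg⟩
    · have hwU := (hQO hw).2
      obtain ⟨D', hD', hanti⟩ := exists_hasFDerivAt_mapF hξ hV hM (τ := τ)
        ((h.contDiffAt w hwU).differentiableAt one_ne_zero)
        ((h.contDiffAt_momMult hξ hV hx hwU).differentiableAt one_ne_zero)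
        (Filter.eventually_of_mem (h.isOpen_domain.mem_nhds hwU) h.constraint)
      have hW : HasFDerivWithinAt (rattleMap ξ Vbar M τ Υ₁) D' (cotangentBundle ξ M ∩ R) w :=
        hD'.hasFDerivWithinAt.congr (hmap.mono hQO) (hmap (hQO hw))
      -- An arbitrary derivative `D` along `Q` agrees on the tangent space with the ambient
      -- derivative `D'`, which is antisymplectic there.
      refine ⟨hW.differentiableWithinAt, fun D hD => liouvilleAbsDet_eq_one_of_antisymplectic
        (fun u hu => eq_zero_of_symplecticForm_eq_zero hξ hM (hgram w hw.1) hu) fun u hu v hv => ?_⟩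
      have huv : ∀ u ∈ tangentSpaceAt ξ M w, (gradXi ξ w.1)ᵀ *ᵥ u.1 = 0 := by
        intro u hu
        obtain ⟨K, hK⟩ := fderiv_phaseConstraint (M := M) hξ w
        exact congrArg Prod.fst ((hK u).symm.trans hu)
      rw [hasFDerivWithinAt_unique_on_tangentSpace hξ (hgram w hw.1) hw.1 hRo hw.2 hD hW hu,
        hasFDerivWithinAt_unique_on_tangentSpace hξ (hgram w hw.1) hw.1 hRo hw.2 hD hW hv]
      exact hanti u v (huv u hu) (huv v hv)
    · rw [himg, hmap (hQO hw)]
      refine Set.Subset.antisymm ?_ (Set.singleton_subset_iff.2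
        ⟨⟨h.branch_mem hx (hQO hw).2, _, _, rfl⟩, (h.branch_mapsTo h' hx hw).1⟩)
      -- Points of the image of `Q` have position in `Y`, where the multiplier is unique.
      rintro w' ⟨⟨hT, a, b, rfl⟩, hR'⟩
      obtain ⟨h1, h2⟩ := h.eq_of_mapF_mem hx (hQO hw).2 hw.1 hT hR'.2.2
      rw [h2, h1]
      rfl
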